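/- Let $(M,I)$ be a complex manifold and let $E\to M$ be a smooth real vector bundle of finite rank, with a smooth connection $\nabla$ whose curvature is of type $(1,1)$, i.e. $R^{\nabla}(I\cdot,I\cdot)=R^{\nabla}(\cdot,\cdot)$. Let $\mathcal C(E)=\{A\in \mathrm{End}\,E \mid A^2=-1\}$ be the twistor space of $E$, and let $\mathcal J^{(\nabla,I)}$ be the almost complex structure on its total space which, with respect to the splitting of $T\mathcal C(E)$ into vertical and $\nabla$-horizontal vectors, is $B\mapsto AB$ on vertical vectors $B\in\mathrm{End}\,E_x$ at $A\in\mathcal C(E_x)$, and is $I$ on horizontal vectors (identified with tangent vectors of $M$). Let $J$ be a smooth section of $\mathcal C(E)$ with $\nabla J=0$, and let $K$ be a smooth section of $\mathcal C(E)$ which is holomorphic as a map $(M,I)\to(\mathcal C(E),\mathcal J^{(\nabla,I)})$. Put $\nabla'=\nabla+\tfrac12(\nabla K)K$. Let $E_{\mathbb C}=E\otimes_{\mathbb R}\mathbb C$, let $\nabla^{0,1}$ and $\nabla'^{0,1}$ be the $(0,1)$-parts of the $\mathbb C$-linear extensions of $\nabla$ and $\nabla'$ to $E_{\mathbb C}$,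 and for $A\in\{J,K\}$ let $E^{1,0}_A$ and $E^{0,1}_A$ be the $+i$ and $-i$ eigenbundles of $A$ in $E_{\mathbb C}$. Then the following are holomorphic bundle maps, where $E^{0,1}_J$, $E^{1,0}_J$ carry the operator $\nabla^{0,1}$, $E^{1,0}_K$ carries $\nabla'^{0,1}$, and $E^{0,1}_K$ carries $\nabla^{0,1}$ (in 5, equally well $\nabla'^{0,1}$): 1. $J+K: E^{0,1}_K\to E^{0,1}_J$; 2. $J-K: E^{0,1}_K\to E^{1,0}_J$; 3. $J+K: E^{1,0}_J\to E^{1,0}_K$; 4. $J-K: E^{0,1}_J\to E^{1,0}_K$; 5. $[J,K]: E^{0,1}_K\to E^{1,0}_K$. Here a map $f:(W_1,\nabla_1^{0,1})\to(W_2,\nabla_2^{0,1})$ is called a holomorphic bundle map if: the connections $\nabla_1,\nabla_2$ are smooth with curvature of type $(1,1)$ (so that $\nabla_1^{0,1}$, $\nabla_2^{0,1}$ are $\bar\partial$-operators on $E_{\mathbb C}$); each $W_k$ is a smooth complex subbundle of $E_{\mathbb C}$ preserved by $\nabla_k^{0,1}$; and $f$ is a smooth complex-linear bundle map that sends $W_1$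 into $W_2$ and satisfies $\nabla_2^{0,1}(fe)=f(\nabla_1^{0,1}e)$ for every smooth section $e$ of $W_1$ over an open set. -/

import Mathlib

open Bundle Topology
open scoped Manifold ContDiff TensorProduct

noncomputable section

namespace HolTwistor

/-! ### The base: a complex manifold, seen as a real manifold with its complex structure -/

section Base

variable {EM : Type*} [NormedAddCommGroup EM] [NormedSpace ℂ EM]
  {M : Type*} [TopologicalSpace M] [ChartedSpace EM M]

/-- A complex manifold is in particular a real manifold. -/
instance isManifold_real (n : WithTop ℕ∞) [IsManifold 𝓘(ℂ, EM) n M] :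
    IsManifold 𝓘(ℝ, EM) n M := by
  apply isManifold_of_contDiffOn
  intro e e' he he'
  have h := (contDiffGroupoid n 𝓘(ℂ, EM)).compatible he he'
  rw [contDiffGroupoid, mem_groupoid_of_pregroupoid] at h
  exact (h.1 : ContDiffOn ℂ n _ _).restrict_scalars ℝ

/-- The complex structure `I` of the complex manifold `M`, as an endomorphism of the real tangent
space: multiplication by `i` in the holomorphic charts. -/
def complexStr (x : M) : TangentSpace 𝓘(ℝ, EM) x →L[ℝ] TangentSpace 𝓘(ℝ, EM) x :=
  show EM →L[ℝ] EM from (Complex.I • ContinuousLinearMap.id ℂ EM).restrictScalars ℝ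

end Base

variable {EM : Type*} [NormedAddCommGroup EM] [NormedSpace ℂ EM]
  {M : Type*} [TopologicalSpace M] [ChartedSpace EM M]
  {F : Type*} [NormedAddCommGroup F] [NormedSpace ℝ F]
  {V : M → Type*} [TopologicalSpace (TotalSpace F V)]
  [∀ x, AddCommGroup (V x)] [∀ x, Module ℝ (V x)] [∀ x, TopologicalSpace (V x)]
  [∀ x, IsTopologicalAddGroup (V x)] [∀ x, ContinuousSMul ℝ (V x)]
  [FiberBundle F V]

/-! ### Curvature -/

section Curvature

/-- `R^∇(X, Y) σ = ∇_X ∇_Y σ - ∇_Y ∇_X σ - ∇_{[X,Y]} σ`. -/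
def curvature (cov : CovariantDerivative 𝓘(ℝ, EM) F V)
    (X Y : Π x : M, TangentSpace 𝓘(ℝ, EM) x) (σ : Π x : M, V x) (x : M) : V x :=
  cov (fun y => cov σ y (Y y)) x (X x) - cov (fun y => cov σ y (X y)) x (Y x)
    - cov σ x (VectorField.mlieBracket 𝓘(ℝ, EM) X Y x)

/-- The curvature of `∇` is of type (1,1): `R^∇(I X, I Y) = R^∇(X, Y)`. -/
def HasCurvatureType11 [IsManifold 𝓘(ℝ, EM) 1 M] (cov : CovariantDerivative 𝓘(ℝ, EM) F V) : Prop :=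
  ∀ (X Y : Π x : M, TangentSpace 𝓘(ℝ, EM) x) (σ : Π x : M, V x),
    ContMDiff 𝓘(ℝ, EM) 𝓘(ℝ, EM).tangent ∞ (fun x => (⟨x, X x⟩ : TangentBundle 𝓘(ℝ, EM) M)) →
    ContMDiff 𝓘(ℝ, EM) 𝓘(ℝ, EM).tangent ∞ (fun x => (⟨x, Y x⟩ : TangentBundle 𝓘(ℝ, EM) M)) →
    ContMDiff 𝓘(ℝ, EM) (𝓘(ℝ, EM).prod 𝓘(ℝ, F)) ∞ (fun x => TotalSpace.mk' F x (σ x)) →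
    ∀ x, curvature cov (fun y => complexStr y (X y)) (fun y => complexStr y (Y y)) σ x
      = curvature cov X Y σ x

end Curvature

/-! ### The induced connection on `End E` -/

section EndConnection

variable [VectorBundle ℝ F V]

/-- `A` is a differentiable section of `End E` at `x`. -/
def EndMDiffAt (F : Type*) [NormedAddCommGroup F] [NormedSpace ℝ F]
    {V : M → Type*} [TopologicalSpace (TotalSpace F V)]
    [∀ x, AddCommGroup (V x)] [∀ x, Module ℝ (V x)] [∀ x, TopologicalSpace (V x)]
    [∀ x, IsTopologicalAddGroup (V x)] [∀ x, ContinuousSMul ℝ (V x)]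
    [FiberBundle F V] [VectorBundle ℝ F V]
    (A : Π x : M, V x →L[ℝ] V x) (x : M) : Prop :=
  MDifferentiableAt 𝓘(ℝ, EM) (𝓘(ℝ, EM).prod 𝓘(ℝ, F →L[ℝ] F))
    (fun y => TotalSpace.mk' (F →L[ℝ] F) (E := fun y => V y →L[ℝ] V y) y (A y)) x

theorem nablaEnd_tensorial (cov : CovariantDerivative 𝓘(ℝ, EM) F V)
    (A : Π x : M, V x →L[ℝ] V x) (x : M) (hA : EndMDiffAt (EM := EM) F A x) :
    TensorialAt 𝓘(ℝ, EM) F (fun σ : Π x : M, V x =>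
      cov (fun y => A y (σ y)) x - (A x).comp (cov σ x)) x where
  smul {f σ} hf hσ := by
    have hAσ := MDifferentiableAt.clm_bundle_apply hA hσ
    have h1 : (fun y => A y ((f • σ) y)) = f • (fun y => A y (σ y)) := by
      ext y; simp
    rw [h1, cov.isCovariantDerivativeOn.leibniz (s := Set.univ) hAσ hf,
      cov.isCovariantDerivativeOn.leibniz (s := Set.univ) hσ hf]
    ext v
    simp [smul_sub]
  add {σ σ'} hσ hσ' := by
    have hAσ := MDifferentiableAt.clm_bundle_apply hA hσ
    have hAσ' := MDifferentiableAt.clm_bundle_apply hA hσ'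
    have h1 : (fun y => A y ((σ + σ') y)) = (fun y => A y (σ y)) + (fun y => A y (σ' y)) := by
      ext y; simp
    rw [h1, cov.isCovariantDerivativeOn.add (s := Set.univ) hAσ hAσ',
      cov.isCovariantDerivativeOn.add (s := Set.univ) hσ hσ']
    ext v
    simp
    abel

variable [FiniteDimensional ℝ F] [ContMDiffVectorBundle ∞ F V 𝓘(ℝ, EM)]

/-- The covariant derivative of a section `A` of `End E`, `(∇_v A) w = ∇_v (A w) - A (∇_v w)`;
the arguments come in the order `nablaEnd cov A x hA w v`. -/
def nablaEnd (cov : CovariantDerivative 𝓘(ℝ, EM) F V)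
    (A : Π x : M, V x →L[ℝ] V x) (x : M) (hA : EndMDiffAt (EM := EM) F A x) :
    V x →L[ℝ] TangentSpace 𝓘(ℝ, EM) x →L[ℝ] V x :=
  TensorialAt.mkHom _ x (nablaEnd_tensorial cov A x hA)

/-- `∇_v A` at `x`, as an endomorphism of the fibre. -/
def nablaEndDir (cov : CovariantDerivative 𝓘(ℝ, EM) F V)
    (A : Π x : M, V x →L[ℝ] V x) (x : M) (hA : EndMDiffAt (EM := EM) F A x)
    (v : TangentSpace 𝓘(ℝ, EM) x) : V x →L[ℝ] V x :=
  { toFun := fun w => nablaEnd cov A x hA w v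
    map_add' := fun w w' => by simp
    map_smul' := fun c w => by simp
    cont := (continuous_eval_const v).comp (nablaEnd cov A x hA).continuous }

end EndConnection

/-! ### The twistor space `C(E)` and its almost complex structure -/

section Twistor

variable [VectorBundle ℝ F V]

/-- The total space of `End E`, in which `C(E) = {A | A² = -1}` lies. -/
abbrev EndTot (F : Type*) [NormedAddCommGroup F] [NormedSpace ℝ F]
    (V : M → Type*) [∀ x, AddCommGroup (V x)] [∀ x, Module ℝ (V x)]
    [∀ x, TopologicalSpace (V x)] : Type _ :=
  TotalSpace (F →L[ℝ] F) (fun x : M => V x →L[ℝ] V x)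

/-- The model with corners of the total space of `End E`. -/
abbrev endModel (EM : Type*) [NormedAddCommGroup EM] [NormedSpace ℂ EM]
    (F : Type*) [NormedAddCommGroup F] [NormedSpace ℝ F] :=
  𝓘(ℝ, EM).prod 𝓘(ℝ, F →L[ℝ] F)

/-- The differential of the projection `π : End E → M`. -/
def dproj (p : EndTot F V) :
    TangentSpace (endModel EM F) p →L[ℝ] TangentSpace 𝓘(ℝ, EM) p.1 :=
  mfderiv (endModel EM F) 𝓘(ℝ, EM) (TotalSpace.proj : EndTot F V → M) p

/-- The vertical lift of `B ∈ End E_x` at `p = (x, A)`: the velocity at `t = 0` of the curve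
`t ↦ (x, A + t B)`. -/
def vertLift (p : EndTot F V) (B : V p.1 →L[ℝ] V p.1) : TangentSpace (endModel EM F) p :=
  have q : TangentSpace (endModel EM F) (⟨p.1, p.2 + (0 : ℝ) • B⟩ : EndTot F V) :=
    mfderiv 𝓘(ℝ, ℝ) (endModel EM F) (fun t : ℝ => (⟨p.1, p.2 + t • B⟩ : EndTot F V)) 0 (1 : ℝ)
  q

theorem endMDiffAt_extend [IsManifold 𝓘(ℝ, EM) 1 M]
    [ContMDiffVectorBundle ∞ F V 𝓘(ℝ, EM)] (x : M) (A : V x →L[ℝ] V x) :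
    EndMDiffAt (EM := EM) F (FiberBundle.extend (F →L[ℝ] F) (E := fun y => V y →L[ℝ] V y) A) x :=
  FiberBundle.mdifferentiableAt_extend ..

variable [FiniteDimensional ℝ F] [ContMDiffVectorBundle ∞ F V 𝓘(ℝ, EM)]

/-- The `∇`-horizontal lift of `v ∈ T_x M` at `p = (x, A)`: it is `ds(v)` minus the vertical lift
of `∇_v s`, where `s` is a section of `End E` with `s(x) = A`. -/
def horLift [IsManifold 𝓘(ℝ, EM) 1 M] (cov : CovariantDerivative 𝓘(ℝ, EM) F V) (p : EndTot F V)
    (v : TangentSpace 𝓘(ℝ, EM) p.1) : TangentSpace (endModel EM F) p :=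
  let s : Π y : M, V y →L[ℝ] V y :=
    FiberBundle.extend (F →L[ℝ] F) (E := fun y => V y →L[ℝ] V y) p.2
  have ds : TangentSpace (endModel EM F) (⟨p.1, s p.1⟩ : EndTot F V) :=
    mfderiv 𝓘(ℝ, EM) (endModel EM F) (fun y => (⟨y, s y⟩ : EndTot F V)) p.1 v
  (show TangentSpace (endModel EM F) p from ds) -
    vertLift p (nablaEndDir cov s p.1 (endMDiffAt_extend p.1 p.2) v)

/-- The vertical component in `End E_x` of a tangent vector at `p = (x, A)`, with respect to the
splitting into vertical and `∇`-horizontal vectors. -/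
def vertPart [IsManifold 𝓘(ℝ, EM) 1 M] (cov : CovariantDerivative 𝓘(ℝ, EM) F V) (p : EndTot F V)
    (ξ : TangentSpace (endModel EM F) p) : V p.1 →L[ℝ] V p.1 :=
  Function.invFun (vertLift p) (ξ - horLift cov p (dproj p ξ))

/-- `𝒥^(∇,I) = 𝒥^V ⊕ π^* I`: on horizontal vectors it is `I`, on vertical vectors at `(x, A)` it is
`B ↦ A B`. At points `(x, A)` with `A² = -1` its restriction to `T C(E)` is the almost complex
structure of the twistor space. -/
def twistorJ [IsManifold 𝓘(ℝ, EM) 1 M] (cov : CovariantDerivative 𝓘(ℝ, EM) F V) (p : EndTot F V)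
    (ξ : TangentSpace (endModel EM F) p) : TangentSpace (endModel EM F) p :=
  horLift cov p (complexStr p.1 (dproj p ξ)) + vertLift p (p.2.comp (vertPart cov p ξ))

end Twistor

section Sections

variable (EM F V) in
/-- A smooth section of the twistor space `C(E) = {J ∈ End E | J² = -1}`. -/
structure TwistorSection [VectorBundle ℝ F V] where
  /-- the endomorphism of each fibre -/
  toFun : Π x : M, V x →L[ℝ] V x
  sq_eq (x : M) : (toFun x).comp (toFun x) = -ContinuousLinearMap.id ℝ (V x)
  contMDiff : ContMDiff 𝓘(ℝ, EM) (endModel EM F) ∞ (fun x => (⟨x, toFun x⟩ : EndTot F V))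

variable [VectorBundle ℝ F V]

instance : CoeFun (TwistorSection EM F V) (fun _ => Π x : M, V x →L[ℝ] V x) := ⟨TwistorSection.toFun⟩

theorem TwistorSection.endMDiffAt (J : TwistorSection EM F V) (x : M) :
    EndMDiffAt (EM := EM) F J x :=
  J.contMDiff.mdifferentiableAt (by simp)

variable [FiniteDimensional ℝ F] [ContMDiffVectorBundle ∞ F V 𝓘(ℝ, EM)]

/-- `∇ J = 0`. -/
def TwistorSection.IsParallel (cov : CovariantDerivative 𝓘(ℝ, EM) F V)
    (J : TwistorSection EM F V) : Prop :=
  ∀ x, nablaEnd cov J x (J.endMDiffAt x) = 0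

/-- `K : (M, I) → (C(E), 𝒥^(∇,I))` is a holomorphic map: `dK ∘ I = 𝒥^(∇,I) ∘ dK`. -/
def TwistorSection.IsHolomorphic [IsManifold 𝓘(ℝ, EM) 1 M]
    (cov : CovariantDerivative 𝓘(ℝ, EM) F V) (K : TwistorSection EM F V) : Prop :=
  ∀ (x : M) (v : TangentSpace 𝓘(ℝ, EM) x),
    mfderiv 𝓘(ℝ, EM) (endModel EM F) (fun y => (⟨y, K y⟩ : EndTot F V)) x (complexStr x v)
      = twistorJ cov ⟨x, K x⟩
          (mfderiv 𝓘(ℝ, EM) (endModel EM F) (fun y => (⟨y, K y⟩ : EndTot F V)) x v)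

/-- The connection `∇' = ∇ + ½ (∇K) K`, that is `∇'_v w = ∇_v w + ½ (∇_v K) (K w)`. -/
def nablaPrime (cov : CovariantDerivative 𝓘(ℝ, EM) F V) (K : TwistorSection EM F V) :
    CovariantDerivative 𝓘(ℝ, EM) F V :=
  cov.addOneForm (fun x => (1 / 2 : ℝ) • (nablaEnd cov K x (K.endMDiffAt x)).comp (K x))

end Sections

/-! ### The complexified bundle `E_ℂ = ℂ ⊗ E` and holomorphic bundle maps -/

section Complexification

/-- Real part of an element of `ℂ ⊗ W`. -/
def reC {W : Type*} [AddCommGroup W] [Module ℝ W] : ℂ ⊗[ℝ] W →ₗ[ℝ] W :=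
  (TensorProduct.lid ℝ W).toLinearMap ∘ₗ Complex.reLm.rTensor W

/-- Imaginary part of an element of `ℂ ⊗ W`. -/
def imC {W : Type*} [AddCommGroup W] [Module ℝ W] : ℂ ⊗[ℝ] W →ₗ[ℝ] W :=
  (TensorProduct.lid ℝ W).toLinearMap ∘ₗ Complex.imLm.rTensor W

variable (EM F) in
/-- The section `e` of `E_ℂ` is smooth on `U`. -/
def SmoothOnC (e : Π x : M, ℂ ⊗[ℝ] V x) (U : Set M) : Prop :=
  ContMDiffOn 𝓘(ℝ, EM) (𝓘(ℝ, EM).prod 𝓘(ℝ, F)) ∞ (fun x => TotalSpace.mk' F x (reC (e x))) U ∧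
  ContMDiffOn 𝓘(ℝ, EM) (𝓘(ℝ, EM).prod 𝓘(ℝ, F)) ∞ (fun x => TotalSpace.mk' F x (imC (e x))) U

/-- The `ℂ`-linear extension of the connection to sections of `E_ℂ`. -/
def nablaC (cov : CovariantDerivative 𝓘(ℝ, EM) F V) (e : Π x : M, ℂ ⊗[ℝ] V x) (x : M)
    (v : TangentSpace 𝓘(ℝ, EM) x) : ℂ ⊗[ℝ] V x :=
  (1 : ℂ) ⊗ₜ[ℝ] cov (fun y => reC (e y)) x v + Complex.I ⊗ₜ[ℝ] cov (fun y => imC (e y)) x v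

/-- The operator `∇^{0,1}`. A (0,1)-form is evaluated on a real vector `v` through
`v^{0,1} = ½ (v + i I v)`, so that `∇^{0,1}_v e = ½ (∇_v e + i ∇_{I v} e)`. -/
def dbar (cov : CovariantDerivative 𝓘(ℝ, EM) F V) (e : Π x : M, ℂ ⊗[ℝ] V x) (x : M)
    (v : TangentSpace 𝓘(ℝ, EM) x) : ℂ ⊗[ℝ] V x :=
  (1 / 2 : ℂ) • (nablaC cov e x v + Complex.I • nablaC cov e x (complexStr x v))

/-- The `ℂ`-linear extension of an endomorphism field to `E_ℂ`. -/
def endC (A : Π x : M, V x →L[ℝ] V x) (x : M) : ℂ ⊗[ℝ] V x →ₗ[ℂ] ℂ ⊗[ℝ] V x :=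
  (A x : V x →ₗ[ℝ] V x).baseChange ℂ

/-- `E^{1,0}_J`, the `i`-eigenbundle of `J` in `E_ℂ`. -/
def E10 (J : Π x : M, V x →L[ℝ] V x) (x : M) : Submodule ℂ (ℂ ⊗[ℝ] V x) :=
  Module.End.eigenspace (endC J x) Complex.I

/-- `E^{0,1}_J`, the `-i`-eigenbundle of `J` in `E_ℂ`. -/
def E01 (J : Π x : M, V x →L[ℝ] V x) (x : M) : Submodule ℂ (ℂ ⊗[ℝ] V x) :=
  Module.End.eigenspace (endC J x) (-Complex.I)

/-- `W` is a smooth complex subbundle of `E_ℂ`: it has smooth local frames. -/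
def IsSmoothSubbundle (EM F : Type*) [NormedAddCommGroup EM] [NormedSpace ℂ EM]
    [NormedAddCommGroup F] [NormedSpace ℝ F] [ChartedSpace EM M]
    {V : M → Type*} [TopologicalSpace (TotalSpace F V)]
    [∀ x, AddCommGroup (V x)] [∀ x, Module ℝ (V x)] [∀ x, TopologicalSpace (V x)]
    [FiberBundle F V] (W : Π x : M, Submodule ℂ (ℂ ⊗[ℝ] V x)) : Prop :=
  ∀ x₀ : M, ∃ (U : Set M) (k : ℕ) (e : Fin k → Π x : M, ℂ ⊗[ℝ] V x), IsOpen U ∧ x₀ ∈ U ∧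
    (∀ j, SmoothOnC EM F (e j) U) ∧
    ∀ x ∈ U, LinearIndependent ℂ (fun j => e j x) ∧
      Submodule.span ℂ (Set.range fun j => e j x) = W x

/-- `W` is a holomorphic subbundle of `(E_ℂ, ∇^{0,1})`: `∇` is a smooth connection whose curvature
is of type (1,1), so that `∇^{0,1}` is a `∂̄`-operator on `E_ℂ`, and `W` is a smooth subbundle
whose (local) smooth sections are preserved by `∇^{0,1}`. -/
structure IsHolomorphicSubbundle [VectorBundle ℝ F V] [IsManifold 𝓘(ℝ, EM) 1 M]
    (cov : CovariantDerivative 𝓘(ℝ, EM) F V) (W : Π x : M, Submodule ℂ (ℂ ⊗[ℝ] V x)) : Prop where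
  smooth_connection : cov.ContMDiffCovariantDerivative ∞
  curvature_type : HasCurvatureType11 cov
  subbundle : IsSmoothSubbundle EM F W
  dbar_mem : ∀ (U : Set M), IsOpen U → ∀ e : Π x : M, ℂ ⊗[ℝ] V x, SmoothOnC EM F e U →
    (∀ x ∈ U, e x ∈ W x) → ∀ x ∈ U, ∀ v, dbar cov e x v ∈ W x

/-- `f : (W₁, ∇₁^{0,1}) → (W₂, ∇₂^{0,1})` is a holomorphic bundle map: both bundles are holomorphic,
`f` is a smooth `ℂ`-linear bundle map, and `∇₂^{0,1} (f e) = f (∇₁^{0,1} e)` for all smooth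
sections `e` of `W₁` over open sets. -/
structure IsHolomorphicBundleMap [VectorBundle ℝ F V] [IsManifold 𝓘(ℝ, EM) 1 M]
    (cov₁ : CovariantDerivative 𝓘(ℝ, EM) F V) (W₁ : Π x : M, Submodule ℂ (ℂ ⊗[ℝ] V x))
    (cov₂ : CovariantDerivative 𝓘(ℝ, EM) F V) (W₂ : Π x : M, Submodule ℂ (ℂ ⊗[ℝ] V x))
    (f : Π x : M, ℂ ⊗[ℝ] V x →ₗ[ℂ] ℂ ⊗[ℝ] V x) : Prop where
  source : IsHolomorphicSubbundle cov₁ W₁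
  target : IsHolomorphicSubbundle cov₂ W₂
  mapsTo : ∀ x, ∀ w ∈ W₁ x, f x w ∈ W₂ x
  smooth : ∀ (U : Set M), IsOpen U → ∀ e : Π x : M, ℂ ⊗[ℝ] V x, SmoothOnC EM F e U →
    (∀ x ∈ U, e x ∈ W₁ x) → SmoothOnC EM F (fun x => f x (e x)) U
  dbar_comm : ∀ (U : Set M), IsOpen U → ∀ e : Π x : M, ℂ ⊗[ℝ] V x, SmoothOnC EM F e U →
    (∀ x ∈ U, e x ∈ W₁ x) → ∀ x ∈ U, ∀ v,
      dbar cov₂ (fun y => f y (e y)) x v = f x (dbar cov₁ e x v)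

end Complexification

end HolTwistor

end

set_option linter.unusedSectionVars false

open Bundle Topology
open scoped Manifold ContDiff TensorProduct

noncomputable section

namespace HolTwistor

/-! Everything rests on two identities for `K`. Differentiating `K² = -1` shows that `∇_v K`
anticommutes with `K`, so it exchanges the two eigenbundles of `K`
(`TwistorSection.nablaEnd_apply_self`). Splitting `dK(v)` into the horizontal lift of `v` and the
vertical lift of `∇_v K` turns holomorphicity into `∇_{Iv} K = K ∇_v K` (`mfderiv_endSection`,
`TwistorSection.IsHolomorphic.nablaEndDir_complexStr`).

Hence the `(0,1)`-part of `∇K` is `½ (1 + iK) ∇_v K`, where `½ (1 + iK)` is the projection onto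
`E^{0,1}_K`. On `E^{0,1}_K` it vanishes, because `∇_v K` leads into `E^{1,0}_K`; so `∇^{0,1}`
preserves `E^{0,1}_K`. There `J + K` is `J - i` and `J - K` is `J + i`, which map into the
eigenbundles of `J` and commute with `∇^{0,1}` since `∇J = 0`. This gives maps 1 and 2.

For the other maps, `∇' = ½ (∇ - K ∇ K)` makes `K` parallel, and its curvature is again of type
(1,1) (`curvature_nablaPrime`, `nablaPrime_curvatureType`). The difference `∇'^{0,1} - ∇^{0,1}`
takes values in `E^{0,1}_K`, the kernel of `i + K`. So `i + K` intertwines `∇^{0,1}` with `∇'^{0,1}`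
and maps into `E^{1,0}_K` (`dbar_nablaPrime_I_add_endC`). Maps 3, 4 and 5 are `i + K` on
`E^{1,0}_J`, `-(i + K)` on `E^{0,1}_J` and `-(i + K) J` on `E^{0,1}_K`
(`isHolomorphicBundleMap_of_eq_I_add_endC`).

That the eigenbundles are smooth follows from local frames in which a given twistor section is
constant (`TwistorSection.exists_adapted_frame`). -/

variable {EM : Type*} [NormedAddCommGroup EM] [NormedSpace ℂ EM]
  {M : Type*} [TopologicalSpace M] [ChartedSpace EM M]
  {F : Type*} [NormedAddCommGroup F] [NormedSpace ℝ F]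
  {V : M → Type*} [TopologicalSpace (TotalSpace F V)]
  [∀ x, AddCommGroup (V x)] [∀ x, Module ℝ (V x)] [∀ x, TopologicalSpace (V x)]
  [∀ x, IsTopologicalAddGroup (V x)] [∀ x, ContinuousSMul ℝ (V x)]
  [FiberBundle F V] [VectorBundle ℝ F V]

/-! ### Derivatives of maps into the total space of a bundle -/

section TotalSpaceDerivative

variable {𝕜 : Type*} [NontriviallyNormedField 𝕜]
  {EN : Type*} [NormedAddCommGroup EN] [NormedSpace 𝕜 EN] {HN : Type*} [TopologicalSpace HN]
  {IN : ModelWithCorners 𝕜 EN HN} {N : Type*} [TopologicalSpace N] [ChartedSpace HN N]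
  {EB : Type*} [NormedAddCommGroup EB] [NormedSpace 𝕜 EB] {HB : Type*} [TopologicalSpace HB]
  {IB : ModelWithCorners 𝕜 EB HB} {B : Type*} [TopologicalSpace B] [ChartedSpace HB B]
  {G : Type*} [NormedAddCommGroup G] [NormedSpace 𝕜 G] {W : B → Type*}
  [TopologicalSpace (TotalSpace G W)] [∀ x, TopologicalSpace (W x)] [FiberBundle G W]

/-- The derivative of a map into the total space of a fiber bundle, in terms of the derivatives of
its base component and of its fiber component in the preferred trivialization. -/
theorem hasMFDerivAt_totalSpace {f : N → TotalSpace G W} {n : N} {f₁ : EN →L[𝕜] EB}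
    {f₂ : EN →L[𝕜] G} (hf : ContinuousAt f n)
    (h₁ : HasMFDerivAt IN IB (fun y => (f y).proj) n f₁)
    (h₂ : HasMFDerivAt IN 𝓘(𝕜, G) (fun y => (trivializationAt G W (f n).proj (f y)).2) n f₂) :
    HasMFDerivAt IN (IB.prod 𝓘(𝕜, G)) f n (f₁.prod f₂) := by
  refine ⟨hf, ?_⟩
  have h := h₁.2.prodMk h₂.2
  -- The extended chart at `f n` is the trivialization followed by the chart of the base, so the
  -- pair of components describes `f` only where `f y` lies in the source of the trivialization.
  have hmem : ∀ y, f y ∈ (trivializationAt G W (f n).proj).source →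
      extChartAt (IB.prod 𝓘(𝕜, G)) (f n) (f y) = (extChartAt IB (f n).proj (f y).proj,
        (trivializationAt G W (f n).proj (f y)).2) := by
    intro y hy
    simp only [FiberBundle.extChartAt, PartialEquiv.trans_apply, PartialEquiv.prod_coe,
      PartialEquiv.refl_coe, OpenPartialHomeomorph.coe_toPartialEquiv, Trivialization.coe_coe]
    rw [Trivialization.coe_fst _ hy]
    rfl
  have hev : ∀ᶠ y in 𝓝 n, f y ∈ (trivializationAt G W (f n).proj).source :=
    hf ((trivializationAt G W (f n).proj).open_source.mem_nhds
      (FiberBundle.mem_trivializationAt_proj_source ..))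
  refine h.congr_of_eventuallyEq ?_ ?_
  · have := extChartAt_preimage_mem_nhdsWithin (I := IN) (x := n) (s := Set.univ)
      (t := {y | f y ∈ (trivializationAt G W (f n).proj).source})
      (by rw [nhdsWithin_univ]; exact hev)
    rw [Set.preimage_univ, Set.univ_inter] at this
    filter_upwards [this] with z hz
    exact hmem _ hz
  · have := hmem n (FiberBundle.mem_trivializationAt_proj_source ..)
    simpa [writtenInExtChartAt, chartAt_self_eq] using this

end TotalSpaceDerivative

/-! ### Connections compared with the trivial connection of a trivialization -/

section LocalRepresentative

/-- The local representative of a section of `V` in the preferred trivialization at `x`. -/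
def locRep (F : Type*) [NormedAddCommGroup F] [NormedSpace ℝ F]
    {V : M → Type*} [TopologicalSpace (TotalSpace F V)]
    [∀ x, AddCommGroup (V x)] [∀ x, Module ℝ (V x)] [∀ x, TopologicalSpace (V x)]
    [∀ x, IsTopologicalAddGroup (V x)] [∀ x, ContinuousSMul ℝ (V x)]
    [FiberBundle F V] [VectorBundle ℝ F V] (x : M) (σ : Π y : M, V y) (y : M) : F :=
  (trivializationAt F V x).continuousLinearMapAt ℝ y (σ y)

theorem locRep_eventuallyEq (x : M) (σ : Π y : M, V y) :
    (fun y => (trivializationAt F V x ⟨y, σ y⟩).2) =ᶠ[𝓝 x] locRep F x σ := by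
  filter_upwards [(trivializationAt F V x).open_baseSet.mem_nhds
    (FiberBundle.mem_baseSet_trivializationAt F V x)] with y hy
  simp [locRep, Trivialization.coe_linearMapAt_of_mem _ hy]

theorem locRep_mdifferentiableAt {x : M} {σ : Π y : M, V y}
    (hσ : MDifferentiableAt 𝓘(ℝ, EM) (𝓘(ℝ, EM).prod 𝓘(ℝ, F))
      (fun y => TotalSpace.mk' F y (σ y)) x) :
    MDifferentiableAt 𝓘(ℝ, EM) 𝓘(ℝ, F) (locRep F x σ) x :=
  ((mdifferentiableAt_section _ _).1 hσ).congr_of_eventuallyEq (locRep_eventuallyEq x σ).symm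

/-- The difference between a covariant derivative and the trivial one of a trivialization is
tensorial. -/
theorem cov_sub_locRep_tensorial (cov : CovariantDerivative 𝓘(ℝ, EM) F V) (x : M) :
    TensorialAt 𝓘(ℝ, EM) F (fun σ : Π y : M, V y =>
      cov σ x - ((trivializationAt F V x).symmL ℝ x).comp
        (mvfderiv 𝓘(ℝ, EM) (locRep F x σ) x)) x where
  smul {f σ} hf hσ := by
    have h1 : locRep F x (f • σ) = f • locRep F x σ := by
      ext y; simp [locRep]
    have hx := FiberBundle.mem_baseSet_trivializationAt F V x
    rw [h1, cov.isCovariantDerivativeOn.leibniz (s := Set.univ) hσ hf,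
      mvfderiv_smul hf (locRep_mdifferentiableAt hσ)]
    ext v
    simp [locRep, smul_sub, hx]
  add {σ σ'} hσ hσ' := by
    have h1 : locRep F x (σ + σ') = locRep F x σ + locRep F x σ' := by
      ext y; simp [locRep]
    rw [h1, cov.isCovariantDerivativeOn.add (s := Set.univ) hσ hσ',
      mvfderiv_add (locRep_mdifferentiableAt hσ) (locRep_mdifferentiableAt hσ')]
    ext v
    simp
    abel

variable [FiniteDimensional ℝ F] [ContMDiffVectorBundle ∞ F V 𝓘(ℝ, EM)]

/-- In a trivialization the connection is the ordinary derivative plus a term of order zero, and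
that term cancels between two sections with the same value at `x`. -/
theorem cov_sub_cov_of_eq (cov : CovariantDerivative 𝓘(ℝ, EM) F V) {x : M}
    {σ τ : Π y : M, V y}
    (hσ : MDifferentiableAt 𝓘(ℝ, EM) (𝓘(ℝ, EM).prod 𝓘(ℝ, F))
      (fun y => TotalSpace.mk' F y (σ y)) x)
    (hτ : MDifferentiableAt 𝓘(ℝ, EM) (𝓘(ℝ, EM).prod 𝓘(ℝ, F))
      (fun y => TotalSpace.mk' F y (τ y)) x)
    (h : σ x = τ x) (v : TangentSpace 𝓘(ℝ, EM) x) :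
    (trivializationAt F V x).continuousLinearMapAt ℝ x (cov σ x v - cov τ x v) =
      mvfderiv 𝓘(ℝ, EM) (locRep F x σ) x v - mvfderiv 𝓘(ℝ, EM) (locRep F x τ) x v := by
  have h1 := DFunLike.congr_fun ((cov_sub_locRep_tensorial cov x).pointwise hσ hτ h) v
  have hx := FiberBundle.mem_baseSet_trivializationAt F V x
  simp only [sub_apply, ContinuousLinearMap.comp_apply] at h1
  rw [sub_eq_sub_iff_sub_eq_sub] at h1
  rw [h1, ← map_sub, Trivialization.continuousLinearMapAt_symmL _ hx]

/-- `∇_v (A σ) = (∇_v A) σ + A (∇_v σ)`. -/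
theorem cov_end_apply (cov : CovariantDerivative 𝓘(ℝ, EM) F V)
    {A : Π x : M, V x →L[ℝ] V x} {x : M} (hA : EndMDiffAt (EM := EM) F A x) {σ : Π y : M, V y}
    (hσ : MDifferentiableAt 𝓘(ℝ, EM) (𝓘(ℝ, EM).prod 𝓘(ℝ, F))
      (fun y => TotalSpace.mk' F y (σ y)) x) (v : TangentSpace 𝓘(ℝ, EM) x) :
    cov (fun y => A y (σ y)) x v = nablaEnd cov A x hA (σ x) v + A x (cov σ x v) := by
  have h := TensorialAt.mkHom_apply (nablaEnd_tensorial cov A x hA) hσ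
  rw [nablaEnd, h]
  simp

end LocalRepresentative

/-! ### Horizontal and vertical parts of the differential of a section of `End E` -/

section TwistorSpace

theorem contMDiffOn_symmL_section {F : Type*} [NormedAddCommGroup F] [NormedSpace ℝ F]
    {V : M → Type*} [TopologicalSpace (TotalSpace F V)] [∀ x, AddCommGroup (V x)]
    [∀ x, Module ℝ (V x)] [∀ x, TopologicalSpace (V x)] [FiberBundle F V] [VectorBundle ℝ F V]
    [ContMDiffVectorBundle ∞ F V 𝓘(ℝ, EM)] (e : Trivialization F (TotalSpace.proj : TotalSpace F V → M))
    [MemTrivializationAtlas e] (c : F) :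
    ContMDiffOn 𝓘(ℝ, EM) (𝓘(ℝ, EM).prod 𝓘(ℝ, F)) ∞
      (fun y => TotalSpace.mk' F y (e.symmL ℝ y c)) e.baseSet := by
  rw [e.contMDiffOn_section_baseSet_iff]
  refine (contMDiffOn_const (c := c)).congr fun y hy => ?_
  rw [Trivialization.symmL_apply _ hy, Trivialization.apply_mk_symm _ hy]

theorem hasMFDerivAt_section {G : Type*} [NormedAddCommGroup G] [NormedSpace ℝ G] {W : M → Type*}
    [TopologicalSpace (TotalSpace G W)] [∀ x, TopologicalSpace (W x)] [FiberBundle G W]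
    {s : Π x : M, W x} {x : M}
    (hs : MDifferentiableAt 𝓘(ℝ, EM) (𝓘(ℝ, EM).prod 𝓘(ℝ, G))
      (fun y => TotalSpace.mk' G y (s y)) x) :
    HasMFDerivAt 𝓘(ℝ, EM) (𝓘(ℝ, EM).prod 𝓘(ℝ, G)) (fun y => TotalSpace.mk' G y (s y)) x
      ((ContinuousLinearMap.id ℝ EM).prod
        (mvfderiv 𝓘(ℝ, EM) (fun y => (trivializationAt G W x ⟨y, s y⟩).2) x)) :=
  hasMFDerivAt_totalSpace hs.continuousAt (hasMFDerivAt_id x)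
    ((mdifferentiableAt_section _ _).1 hs).hasMFDerivAt

/-- The fibre component of an endomorphism in the preferred trivialization at its base point. -/
def endCoord (F : Type*) [NormedAddCommGroup F] [NormedSpace ℝ F]
    {V : M → Type*} [TopologicalSpace (TotalSpace F V)]
    [∀ x, AddCommGroup (V x)] [∀ x, Module ℝ (V x)] [∀ x, TopologicalSpace (V x)]
    [∀ x, IsTopologicalAddGroup (V x)] [∀ x, ContinuousSMul ℝ (V x)]
    [FiberBundle F V] [VectorBundle ℝ F V] (x : M) (B : V x →L[ℝ] V x) : F →L[ℝ] F :=
  ((trivializationAt F V x).continuousLinearMapAt ℝ x).comp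
    (B.comp ((trivializationAt F V x).symmL ℝ x))

theorem trivializationAt_end_snd (x y : M) (B : V y →L[ℝ] V y) :
    (trivializationAt (F →L[ℝ] F) (fun y => V y →L[ℝ] V y) x ⟨y, B⟩).2 =
      ((trivializationAt F V x).continuousLinearMapAt ℝ y).comp
        (B.comp ((trivializationAt F V x).symmL ℝ y)) := by
  rw [hom_trivializationAt_apply]
  rfl

theorem endCoord_injective (x : M) : Function.Injective (endCoord F (V := V) x) := by
  intro A B h
  have hx := FiberBundle.mem_baseSet_trivializationAt F V x
  ext w
  have h1 := DFunLike.congr_fun h ((trivializationAt F V x).continuousLinearMapAt ℝ x w)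
  simp only [endCoord, ContinuousLinearMap.comp_apply,
    Trivialization.symmL_continuousLinearMapAt _ hx] at h1
  have h2 := congrArg ((trivializationAt F V x).symmL ℝ x) h1
  rwa [Trivialization.symmL_continuousLinearMapAt _ hx,
    Trivialization.symmL_continuousLinearMapAt _ hx] at h2

/-- The curve `t ↦ A + tB` has a constant base point and an affine fibre component in the
trivialization. -/
theorem vertLift_eq (p : EndTot F V) (B : V p.1 →L[ℝ] V p.1) :
    vertLift (EM := EM) p B = ((0 : EM), endCoord F p.1 B) := by
  have h2 : (fun t : ℝ => (trivializationAt (F →L[ℝ] F) (fun y => V y →L[ℝ] V y) p.1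
      (⟨p.1, p.2 + t • B⟩ : EndTot F V)).2) =
      fun t : ℝ => endCoord F p.1 p.2 + t • endCoord F p.1 B := by
    ext t : 1
    rw [trivializationAt_end_snd]
    ext w
    simp [endCoord]
  have h3 : HasMFDerivAt 𝓘(ℝ, ℝ) 𝓘(ℝ, F →L[ℝ] F)
      (fun t : ℝ => (trivializationAt (F →L[ℝ] F) (fun y => V y →L[ℝ] V y) p.1
        (⟨p.1, p.2 + t • B⟩ : EndTot F V)).2) 0
      ((ContinuousLinearMap.id ℝ ℝ).smulRight (endCoord F p.1 B)) := by
    rw [h2]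
    exact (((hasFDerivAt_id (0 : ℝ)).smul_const _).const_add _).hasMFDerivAt
  have h1 : HasMFDerivAt 𝓘(ℝ, ℝ) 𝓘(ℝ, EM)
      (fun t : ℝ => (⟨p.1, p.2 + t • B⟩ : EndTot F V).proj) 0 (0 : ℝ →L[ℝ] EM) :=
    hasMFDerivAt_const p.1 0
  have hc : MDifferentiableAt 𝓘(ℝ, ℝ) (endModel EM F)
      (fun t : ℝ => (⟨p.1, p.2 + t • B⟩ : EndTot F V)) 0 :=
    (mdifferentiableAt_totalSpace _ _).2 ⟨h1.mdifferentiableAt, h3.mdifferentiableAt⟩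
  have h := (hasMFDerivAt_totalSpace hc.continuousAt h1 h3).mfderiv
  have h' := DFunLike.congr_fun h (1 : ℝ)
  exact Eq.trans (b := _) h' (Prod.ext rfl (one_smul ℝ (endCoord F p.1 B)))

/-- Makes the `Function.invFun` in `vertPart` an honest left inverse on vertical vectors. -/
theorem vertLift_injective (p : EndTot F V) : Function.Injective (vertLift (EM := EM) p) := by
  intro A B h
  rw [vertLift_eq, vertLift_eq] at h
  exact endCoord_injective _ (Prod.ext_iff.1 h).2

theorem dproj_mfderiv_endSection {A : Π x : M, V x →L[ℝ] V x} {x : M}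
    (hA : EndMDiffAt (EM := EM) F A x) (v : TangentSpace 𝓘(ℝ, EM) x) :
    dproj (⟨x, A x⟩ : EndTot F V)
      (mfderiv 𝓘(ℝ, EM) (endModel EM F) (fun y => (⟨y, A y⟩ : EndTot F V)) x v) = v := by
  have h1 : MDifferentiableAt (endModel EM F) 𝓘(ℝ, EM) (TotalSpace.proj : EndTot F V → M)
      ⟨x, A x⟩ := mdifferentiableAt_proj _
  have h := (h1.hasMFDerivAt.comp x hA.hasMFDerivAt).mfderiv
  have h2 : (TotalSpace.proj : EndTot F V → M) ∘ (fun y => (⟨y, A y⟩ : EndTot F V)) = id := rfl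
  rw [h2, mfderiv_id] at h
  exact (DFunLike.congr_fun h v).symm

variable [FiniteDimensional ℝ F] [ContMDiffVectorBundle ∞ F V 𝓘(ℝ, EM)]

/-- The analogue of `cov_sub_cov_of_eq` for `End E`, obtained by evaluating on sections of `E` that
are constant in the trivialization: `Aσ` and `Bσ` agree at `x`, and the Leibniz terms `A(∇σ)` and
`B(∇σ)` cancel there. -/
theorem endCoord_nablaEndDir_sub (cov : CovariantDerivative 𝓘(ℝ, EM) F V)
    {A B : Π x : M, V x →L[ℝ] V x} {x : M} (hA : EndMDiffAt (EM := EM) F A x)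
    (hB : EndMDiffAt (EM := EM) F B x) (h : A x = B x) (v : TangentSpace 𝓘(ℝ, EM) x) :
    endCoord F x (nablaEndDir cov A x hA v - nablaEndDir cov B x hB v) =
      mvfderiv 𝓘(ℝ, EM) (fun y => (trivializationAt (F →L[ℝ] F) (fun y => V y →L[ℝ] V y) x
        ⟨y, A y⟩).2) x v -
      mvfderiv 𝓘(ℝ, EM) (fun y => (trivializationAt (F →L[ℝ] F) (fun y => V y →L[ℝ] V y) x
        ⟨y, B y⟩).2) x v := by
  have hx := FiberBundle.mem_baseSet_trivializationAt F V x
  ext c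
  let σ : Π y : M, V y := fun y => (trivializationAt F V x).symmL ℝ y c
  have hσ : MDifferentiableAt 𝓘(ℝ, EM) (𝓘(ℝ, EM).prod 𝓘(ℝ, F))
      (fun y => TotalSpace.mk' F y (σ y)) x :=
    ((contMDiffOn_symmL_section (trivializationAt F V x) c).contMDiffAt
      ((trivializationAt F V x).open_baseSet.mem_nhds hx)).mdifferentiableAt (by simp)
  have key : ∀ {A : Π x : M, V x →L[ℝ] V x} (hA : EndMDiffAt (EM := EM) F A x),
      mvfderiv 𝓘(ℝ, EM) (fun y => (trivializationAt (F →L[ℝ] F) (fun y => V y →L[ℝ] V y) x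
        ⟨y, A y⟩).2) x v c = mvfderiv 𝓘(ℝ, EM) (locRep F x (fun y => A y (σ y))) x v := by
    intro A hA
    have h1 := (mdifferentiableAt_section _ _).1 hA
    have h2 : locRep F x (fun y => A y (σ y)) = fun y =>
        (trivializationAt (F →L[ℝ] F) (fun y => V y →L[ℝ] V y) x ⟨y, A y⟩).2 c := by
      ext y
      rw [trivializationAt_end_snd]
      rfl
    rw [h2]
    have h3 := ((ContinuousLinearMap.apply ℝ F c).hasMFDerivAt.comp x h1.hasMFDerivAt).mfderiv
    exact (DFunLike.congr_fun h3 v).symm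
  rw [sub_apply, key hA, key hB, ← cov_sub_cov_of_eq cov (hA.clm_bundle_apply hσ)
    (hB.clm_bundle_apply hσ) (by simp [h]), cov_end_apply cov hA hσ, cov_end_apply cov hB hσ]
  simp [endCoord, h, nablaEndDir, σ]

variable [IsManifold 𝓘(ℝ, EM) 1 M]

/-- `horLift` is defined through one chosen extension of `A x`. Replacing that extension by `A`
changes the differential by a vertical vector, and the covariant derivative by the same
endomorphism, so the horizontal lift does not see the choice. -/
theorem mfderiv_endSection (cov : CovariantDerivative 𝓘(ℝ, EM) F V)
    {A : Π x : M, V x →L[ℝ] V x} {x : M} (hA : EndMDiffAt (EM := EM) F A x)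
    (v : TangentSpace 𝓘(ℝ, EM) x) :
    mfderiv 𝓘(ℝ, EM) (endModel EM F) (fun y => (⟨y, A y⟩ : EndTot F V)) x v =
      horLift cov ⟨x, A x⟩ v + vertLift (⟨x, A x⟩ : EndTot F V) (nablaEndDir cov A x hA v) := by
  set s : Π y : M, V y →L[ℝ] V y :=
    FiberBundle.extend (F →L[ℝ] F) (E := fun y => V y →L[ℝ] V y) (A x)
  have hs : EndMDiffAt (EM := EM) F s x := endMDiffAt_extend x (A x)
  have hsx : s x = A x := by simp [s]
  have e1 := DFunLike.congr_fun (hasMFDerivAt_section hA).mfderiv v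
  have e2 := DFunLike.congr_fun (hasMFDerivAt_section hs).mfderiv v
  have e3 := endCoord_nablaEndDir_sub cov hA hs hsx.symm v
  have e4 : endCoord F x (nablaEndDir cov A x hA v - nablaEndDir cov s x hs v) =
      endCoord F x (nablaEndDir cov A x hA v) - endCoord F x (nablaEndDir cov s x hs v) := by
    ext w; simp [endCoord]
  -- The tangent space of the total space unfolds to this product, so what is left is linear algebra
  -- in pairs (base part, fibre part).
  have hdiff : ∀ (d w l u : EM × (F →L[ℝ] F)) (v : EM) (a a' b b' : F →L[ℝ] F),
      l = (v, a) → d = (v, a') → w = (0, b') → u = (0, b) → b - b' = a - a' →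
        l = d - w + u := by
    rintro _ _ _ _ v a a' b b' rfl rfl rfl rfl h
    ext1
    · simp
    · simp [sub_add, ← neg_sub b b', h]
  exact hdiff _ _ _ _ v _ _ _ _ e1 e2 (vertLift_eq _ _) (vertLift_eq _ _) (e4.symm.trans e3)

/-- A holomorphic section of the twistor space satisfies `∇_{I v} K = K ∇_v K`. -/
theorem TwistorSection.IsHolomorphic.nablaEndDir_complexStr
    {cov : CovariantDerivative 𝓘(ℝ, EM) F V} {K : TwistorSection EM F V}
    (hK : K.IsHolomorphic cov) (x : M) (v : TangentSpace 𝓘(ℝ, EM) x) :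
    nablaEndDir cov K x (K.endMDiffAt x) (complexStr x v) =
      (K x).comp (nablaEndDir cov K x (K.endMDiffAt x) v) := by
  have h := hK x v
  -- The vertical part of `dK(v)` is `∇_v K`; comparing vertical parts in `dK(Iv) = 𝒥 dK(v)` then
  -- gives the claim.
  have hv : vertPart cov (⟨x, K x⟩ : EndTot F V)
      (mfderiv 𝓘(ℝ, EM) (endModel EM F) (fun y => (⟨y, K y⟩ : EndTot F V)) x v) =
      nablaEndDir cov K x (K.endMDiffAt x) v := by
    rw [vertPart, dproj_mfderiv_endSection (K.endMDiffAt x),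
      mfderiv_endSection cov (K.endMDiffAt x), add_sub_cancel_left]
    exact Function.leftInverse_invFun (vertLift_injective _) _
  rw [twistorJ, hv, dproj_mfderiv_endSection (K.endMDiffAt x),
    mfderiv_endSection cov (K.endMDiffAt x)] at h
  exact vertLift_injective _ (add_left_cancel h)

end TwistorSpace

/-! ### Smoothness of the complex structure `I` -/

section ComplexStructure

/-- Both sides are derivatives of the same chart transition, and derivatives are unique. -/
theorem tangentCoordChange_real_eq [IsManifold 𝓘(ℂ, EM) 1 M] {x y z : M}
    (h : z ∈ (chartAt EM x).source ∩ (chartAt EM y).source) :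
    tangentCoordChange 𝓘(ℝ, EM) x y z =
      (tangentCoordChange 𝓘(ℂ, EM) x y z).restrictScalars ℝ := by
  have h1 := hasFDerivWithinAt_tangentCoordChange (I := 𝓘(ℝ, EM)) (x := x) (y := y) (z := z)
    (by simpa using h)
  have h2 := (hasFDerivWithinAt_tangentCoordChange (I := 𝓘(ℂ, EM)) (x := x) (y := y) (z := z)
    (by simpa using h)).restrictScalars ℝ
  have hr : ∀ a : EM, UniqueDiffWithinAt ℝ (Set.range 𝓘(ℝ, EM)) a := by
    intro a; simp
  exact (hr _).eq h1 h2

/-- The complex structure of a complex manifold maps smooth vector fields to smooth vector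
fields. -/
theorem contMDiff_complexStr [IsManifold 𝓘(ℂ, EM) ω M] {X : Π x : M, TangentSpace 𝓘(ℝ, EM) x}
    (hX : ContMDiff 𝓘(ℝ, EM) 𝓘(ℝ, EM).tangent ∞
      (fun x => (⟨x, X x⟩ : TangentBundle 𝓘(ℝ, EM) M))) :
    ContMDiff 𝓘(ℝ, EM) 𝓘(ℝ, EM).tangent ∞
      (fun x => (⟨x, complexStr x (X x)⟩ : TangentBundle 𝓘(ℝ, EM) M)) := by
  intro x
  have h1 := (contMDiffAt_section (F := EM) (E := TangentSpace 𝓘(ℝ, EM)) x).1 (hX x)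
  refine (contMDiffAt_section (F := EM) (E := TangentSpace 𝓘(ℝ, EM)) x).2 ?_
  let L : EM →L[ℝ] EM := (Complex.I • ContinuousLinearMap.id ℂ EM).restrictScalars ℝ
  refine (L.contMDiff.contMDiffAt.comp x h1).congr_of_eventuallyEq ?_
  filter_upwards [(chartAt EM x).open_source.mem_nhds (mem_chart_source EM x)] with y hy
  change tangentCoordChange 𝓘(ℝ, EM) y x y (L (X y)) =
    L (tangentCoordChange 𝓘(ℝ, EM) y x y (X y))
  -- Transitions between holomorphic charts have complex-linear derivative, so they commute with
  -- multiplication by `i`: in coordinates `I` is a constant map.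
  rw [tangentCoordChange_real_eq ⟨mem_chart_source EM y, hy⟩]
  exact map_smul (tangentCoordChange 𝓘(ℂ, EM) y x y) Complex.I (show EM from X y)

end ComplexStructure

/-! ### The connection `∇'`: `K` is parallel, and the curvature has type (1,1) -/

section NablaPrime

theorem TwistorSection.apply_apply (J : TwistorSection EM F V) (x : M) (w : V x) :
    J x (J x w) = -w :=
  DFunLike.congr_fun (J.sq_eq x) w

theorem cov_neg (cov : CovariantDerivative 𝓘(ℝ, EM) F V) {x : M} {σ : Π y : M, V y}
    (hσ : MDifferentiableAt 𝓘(ℝ, EM) (𝓘(ℝ, EM).prod 𝓘(ℝ, F))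
      (fun y => TotalSpace.mk' F y (σ y)) x) :
    cov (-σ) x = -cov σ x := by
  have h := cov.isCovariantDerivativeOn (s := Set.univ) |>.smul_const (-1) hσ
  simpa using h

theorem cov_sub (cov : CovariantDerivative 𝓘(ℝ, EM) F V) {x : M} {σ τ : Π y : M, V y}
    (hσ : MDifferentiableAt 𝓘(ℝ, EM) (𝓘(ℝ, EM).prod 𝓘(ℝ, F))
      (fun y => TotalSpace.mk' F y (σ y)) x)
    (hτ : MDifferentiableAt 𝓘(ℝ, EM) (𝓘(ℝ, EM).prod 𝓘(ℝ, F))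
      (fun y => TotalSpace.mk' F y (τ y)) x) :
    cov (σ - τ) x = cov σ x - cov τ x := by
  rw [sub_eq_add_neg, cov.isCovariantDerivativeOn.add (s := Set.univ) hσ
    (mdifferentiableAt_neg_section hτ), cov_neg cov hτ, sub_eq_add_neg]

theorem contMDiffAt_hom_comp {G : Type*} [NormedAddCommGroup G] [NormedSpace ℝ G] {W : M → Type*}
    [TopologicalSpace (TotalSpace G W)] [∀ x, AddCommGroup (W x)] [∀ x, Module ℝ (W x)]
    [∀ x, TopologicalSpace (W x)] [FiberBundle G W] [VectorBundle ℝ G W] {n : WithTop ℕ∞}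
    {A : Π x : M, V x →L[ℝ] V x} {B : Π x : M, W x →L[ℝ] V x} {x : M}
    (hA : ContMDiffAt 𝓘(ℝ, EM) (𝓘(ℝ, EM).prod 𝓘(ℝ, F →L[ℝ] F)) n
      (fun y => TotalSpace.mk' (F →L[ℝ] F) (E := fun y => V y →L[ℝ] V y) y (A y)) x)
    (hB : ContMDiffAt 𝓘(ℝ, EM) (𝓘(ℝ, EM).prod 𝓘(ℝ, G →L[ℝ] F)) n
      (fun y => TotalSpace.mk' (G →L[ℝ] F) (E := fun y => W y →L[ℝ] V y) y (B y)) x) :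
    ContMDiffAt 𝓘(ℝ, EM) (𝓘(ℝ, EM).prod 𝓘(ℝ, G →L[ℝ] F)) n
      (fun y => TotalSpace.mk' (G →L[ℝ] F) (E := fun y => W y →L[ℝ] V y) y
        ((A y).comp (B y))) x := by
  rw [contMDiffAt_hom_bundle] at hA hB ⊢
  refine ⟨contMDiffAt_id, (hA.2.clm_comp hB.2).congr_of_eventuallyEq ?_⟩
  filter_upwards [(trivializationAt F V x).open_baseSet.mem_nhds
    (FiberBundle.mem_baseSet_trivializationAt F V x)] with y hy
  ext c
  simp [ContinuousLinearMap.inCoordinates, hy]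

variable [FiniteDimensional ℝ F] [ContMDiffVectorBundle ∞ F V 𝓘(ℝ, EM)]

/-- `∇_v K` anticommutes with `K`. -/
theorem TwistorSection.nablaEnd_apply_self (cov : CovariantDerivative 𝓘(ℝ, EM) F V)
    (K : TwistorSection EM F V) (x : M) (w : V x) (v : TangentSpace 𝓘(ℝ, EM) x) :
    nablaEnd cov K x (K.endMDiffAt x) (K x w) v =
      -K x (nablaEnd cov K x (K.endMDiffAt x) w v) := by
  have hσ : MDifferentiableAt 𝓘(ℝ, EM) (𝓘(ℝ, EM).prod 𝓘(ℝ, F))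
      (fun y => TotalSpace.mk' F y (FiberBundle.extend F w y)) x :=
    FiberBundle.mdifferentiableAt_extend ..
  have hK := K.endMDiffAt x
  -- Apply the Leibniz rule twice to `K(Kσ) = -σ`; the terms in `∇σ` cancel.
  have h1 := cov_end_apply cov hK (hK.clm_bundle_apply hσ) v
  rw [cov_end_apply cov hK hσ] at h1
  have h2 : (fun y => K y (K y (FiberBundle.extend F w y))) = -FiberBundle.extend F w := by
    ext y; exact K.apply_apply y _
  rw [h2, cov_neg cov hσ] at h1
  simp only [neg_apply, map_add, K.apply_apply, FiberBundle.extend_apply_self] at h1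
  rw [eq_neg_iff_add_eq_zero]
  have h3 := congrArg (fun z => z + cov (FiberBundle.extend F w) x v) h1
  simp only [neg_add_cancel] at h3
  rw [h3]
  abel

/-- `∇' = ½ (∇ - K ∇ K)`. -/
theorem nablaPrime_apply (cov : CovariantDerivative 𝓘(ℝ, EM) F V) (K : TwistorSection EM F V)
    {x : M} {σ : Π y : M, V y}
    (hσ : MDifferentiableAt 𝓘(ℝ, EM) (𝓘(ℝ, EM).prod 𝓘(ℝ, F))
      (fun y => TotalSpace.mk' F y (σ y)) x) (v : TangentSpace 𝓘(ℝ, EM) x) :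
    nablaPrime cov K σ x v =
      (1 / 2 : ℝ) • (cov σ x v - K x (cov (fun y => K y (σ y)) x v)) := by
  change cov σ x v + (1 / 2 : ℝ) • nablaEnd cov K x (K.endMDiffAt x) (K x (σ x)) v = _
  rw [cov_end_apply cov (K.endMDiffAt x) hσ, map_add, K.apply_apply, K.nablaEnd_apply_self]
  module

/-- `K` is parallel for `∇'`. -/
theorem nablaPrime_self_apply (cov : CovariantDerivative 𝓘(ℝ, EM) F V)
    (K : TwistorSection EM F V) {x : M} {σ : Π y : M, V y}
    (hσ : MDifferentiableAt 𝓘(ℝ, EM) (𝓘(ℝ, EM).prod 𝓘(ℝ, F))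
      (fun y => TotalSpace.mk' F y (σ y)) x) (v : TangentSpace 𝓘(ℝ, EM) x) :
    nablaPrime cov K (fun y => K y (σ y)) x v = K x (nablaPrime cov K σ x v) := by
  have hK := K.endMDiffAt x
  have h2 : (fun y => K y (K y (σ y))) = -σ := by
    ext y; exact K.apply_apply y _
  rw [nablaPrime_apply cov K (hK.clm_bundle_apply hσ), nablaPrime_apply cov K hσ, h2,
    cov_neg cov hσ, map_smul, map_sub, K.apply_apply, neg_apply, map_neg]
  module

/-- Lets the facts about parallel sections, proved with `J` in mind, apply to the pair `∇'`, `K`. -/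
theorem nablaPrime_parallel (cov : CovariantDerivative 𝓘(ℝ, EM) F V)
    (K : TwistorSection EM F V) : K.IsParallel (nablaPrime cov K) := by
  intro x
  ext w v
  have hσ : MDifferentiableAt 𝓘(ℝ, EM) (𝓘(ℝ, EM).prod 𝓘(ℝ, F))
      (fun y => TotalSpace.mk' F y (FiberBundle.extend F w y)) x :=
    FiberBundle.mdifferentiableAt_extend ..
  have h := cov_end_apply (nablaPrime cov K) (K.endMDiffAt x) hσ v
  rw [nablaPrime_self_apply cov K hσ, right_eq_add, FiberBundle.extend_apply_self] at h
  exact h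

variable [IsManifold 𝓘(ℝ, EM) 1 M]

theorem contMDiff_cov_apply {cov : CovariantDerivative 𝓘(ℝ, EM) F V}
    (hcov : cov.ContMDiffCovariantDerivative ∞) {σ : Π x : M, V x}
    (hσ : ContMDiff 𝓘(ℝ, EM) (𝓘(ℝ, EM).prod 𝓘(ℝ, F)) ∞ (fun x => TotalSpace.mk' F x (σ x)))
    {X : Π x : M, TangentSpace 𝓘(ℝ, EM) x}
    (hX : ContMDiff 𝓘(ℝ, EM) 𝓘(ℝ, EM).tangent ∞
      (fun x => (⟨x, X x⟩ : TangentBundle 𝓘(ℝ, EM) M))) :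
    ContMDiff 𝓘(ℝ, EM) (𝓘(ℝ, EM).prod 𝓘(ℝ, F)) ∞
      (fun x => TotalSpace.mk' F x (cov σ x (X x))) := by
  have h := hcov.contMDiff.contMDiff (σ := σ) (by rw [contMDiffOn_univ]; simpa using hσ)
  rw [contMDiffOn_univ] at h
  exact h.clm_bundle_apply hX

/-- Written as `½ (∇σ - K ∇(Kσ))`, the connection is built from smooth operations on sections, and
smoothness of `∇K` as a tensor is never needed. -/
theorem nablaPrime_smooth {cov : CovariantDerivative 𝓘(ℝ, EM) F V}
    (hcov : cov.ContMDiffCovariantDerivative ∞) (K : TwistorSection EM F V) :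
    (nablaPrime cov K).ContMDiffCovariantDerivative ∞ := by
  refine ⟨⟨fun {σ} hσ => ?_⟩⟩
  have hσ' : ContMDiff 𝓘(ℝ, EM) (𝓘(ℝ, EM).prod 𝓘(ℝ, F)) ∞
      (fun x => TotalSpace.mk' F x (σ x)) := by
    rw [contMDiffOn_univ] at hσ
    simpa using hσ
  have hKσ := K.contMDiff.clm_bundle_apply hσ'
  have h1 := hcov.contMDiff.contMDiff (σ := σ) hσ
  have h2 := hcov.contMDiff.contMDiff (σ := fun y => K y (σ y))
    (by rw [contMDiffOn_univ]; simpa using hKσ)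
  rw [contMDiffOn_univ] at h1 h2 ⊢
  have h3 : ContMDiff 𝓘(ℝ, EM) (𝓘(ℝ, EM).prod 𝓘(ℝ, EM →L[ℝ] F)) ∞
      (fun y => TotalSpace.mk' (EM →L[ℝ] F) (E := fun y => TangentSpace 𝓘(ℝ, EM) y →L[ℝ] V y) y
        ((K y).comp (cov (fun y => K y (σ y)) y))) :=
    fun x => contMDiffAt_hom_comp (K.contMDiff x) (h2 x)
  have h4 := (h1.sub_section h3).const_smul_section (a := (1 / 2 : ℝ))
  refine h4.congr fun x => ?_
  congr 1
  ext v
  exact nablaPrime_apply cov K (hσ'.mdifferentiableAt (by simp)) v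

/-- The curvature of `∇'` is `½ (R - K R K) - ¼ [∇K, ∇K]`. -/
theorem curvature_nablaPrime {cov : CovariantDerivative 𝓘(ℝ, EM) F V}
    (hcov : cov.ContMDiffCovariantDerivative ∞) (K : TwistorSection EM F V) {σ : Π x : M, V x}
    (hσ : ContMDiff 𝓘(ℝ, EM) (𝓘(ℝ, EM).prod 𝓘(ℝ, F)) ∞ (fun x => TotalSpace.mk' F x (σ x)))
    {X Y : Π x : M, TangentSpace 𝓘(ℝ, EM) x}
    (hX : ContMDiff 𝓘(ℝ, EM) 𝓘(ℝ, EM).tangent ∞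
      (fun x => (⟨x, X x⟩ : TangentBundle 𝓘(ℝ, EM) M)))
    (hY : ContMDiff 𝓘(ℝ, EM) 𝓘(ℝ, EM).tangent ∞
      (fun x => (⟨x, Y x⟩ : TangentBundle 𝓘(ℝ, EM) M))) (x : M) :
    curvature (nablaPrime cov K) X Y σ x =
      (1 / 2 : ℝ) • (curvature cov X Y σ x - K x (curvature cov X Y (fun y => K y (σ y)) x)) -
      (1 / 4 : ℝ) • (nablaEndDir cov K x (K.endMDiffAt x) (X x)
          (nablaEndDir cov K x (K.endMDiffAt x) (Y x) (σ x)) -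
        nablaEndDir cov K x (K.endMDiffAt x) (Y x)
          (nablaEndDir cov K x (K.endMDiffAt x) (X x) (σ x))) := by
  have hKσ := K.contMDiff.clm_bundle_apply hσ
  have hmd : ∀ {τ : Π x : M, V x}, ContMDiff 𝓘(ℝ, EM) (𝓘(ℝ, EM).prod 𝓘(ℝ, F)) ∞
      (fun x => TotalSpace.mk' F x (τ x)) → ∀ x, MDifferentiableAt 𝓘(ℝ, EM)
      (𝓘(ℝ, EM).prod 𝓘(ℝ, F)) (fun x => TotalSpace.mk' F x (τ x)) x :=
    fun h x => h.mdifferentiableAt (by simp)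
  -- The second derivative before antisymmetrization. The terms with one derivative on `K` and one
  -- on `σ` cancel because `∇K` anticommutes with `K`; only the product of two derivatives of `K`
  -- survives.
  have second : ∀ {X Y : Π x : M, TangentSpace 𝓘(ℝ, EM) x},
      ContMDiff 𝓘(ℝ, EM) 𝓘(ℝ, EM).tangent ∞
        (fun x => (⟨x, Y x⟩ : TangentBundle 𝓘(ℝ, EM) M)) →
      nablaPrime cov K (fun y => nablaPrime cov K σ y (Y y)) x (X x) =
      (1 / 2 : ℝ) • (cov (fun y => cov σ y (Y y)) x (X x) -
        K x (cov (fun y => cov (fun y => K y (σ y)) y (Y y)) x (X x))) -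
      (1 / 4 : ℝ) • nablaEnd cov K x (K.endMDiffAt x)
          (nablaEnd cov K x (K.endMDiffAt x) (σ x) (Y x)) (X x) := by
    intro X Y hY
    have hK := K.endMDiffAt x
    have hD := contMDiff_cov_apply hcov hσ hY
    have hDK := contMDiff_cov_apply hcov hKσ hY
    have hKD := K.contMDiff.clm_bundle_apply hD
    have hKDK := K.contMDiff.clm_bundle_apply hDK
    have e1 : (fun y => nablaPrime cov K σ y (Y y)) = (1 / 2 : ℝ) •
        ((fun y => cov σ y (Y y)) - fun y => K y (cov (fun y => K y (σ y)) y (Y y))) := by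
      ext y
      exact nablaPrime_apply cov K (hmd hσ y) (Y y)
    have e2 : (fun y => K y (nablaPrime cov K σ y (Y y))) = (1 / 2 : ℝ) •
        ((fun y => K y (cov σ y (Y y))) + fun y => cov (fun y => K y (σ y)) y (Y y)) := by
      ext y
      simp [nablaPrime_apply cov K (hmd hσ y) (Y y), K.apply_apply]
    have e3 : MDifferentiableAt 𝓘(ℝ, EM) (𝓘(ℝ, EM).prod 𝓘(ℝ, F))
        (fun y => TotalSpace.mk' F y ((fun y => nablaPrime cov K σ y (Y y)) y)) x := by
      rw [e1]
      exact hmd ((hD.sub_section hKDK).const_smul_section) x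
    rw [nablaPrime_apply cov K e3, e2, e1,
      cov.isCovariantDerivativeOn.smul_const (s := Set.univ) _
        (hmd (hD.sub_section hKDK) x),
      cov.isCovariantDerivativeOn.smul_const (s := Set.univ) _
        (hmd (hKD.add_section hDK) x),
      cov_sub cov (hmd hD x) (hmd hKDK x),
      cov.isCovariantDerivativeOn.add (s := Set.univ) (hmd hKD x) (hmd hDK x)]
    simp only [smul_apply, add_apply, sub_apply, map_add, map_smul]
    rw [cov_end_apply cov hK (hmd hD x), cov_end_apply cov hK (hmd hDK x),
      cov_end_apply cov hK (hmd hσ x)]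
    simp only [map_add, add_apply, K.apply_apply, K.nablaEnd_apply_self]
    module
  rw [curvature, second hY, second hX, nablaPrime_apply cov K (hmd hσ x)]
  simp only [curvature, map_sub]
  simp only [nablaEndDir, ContinuousLinearMap.coe_mk', LinearMap.coe_mk, AddHom.coe_mk]
  module

/-- In `curvature_nablaPrime` the terms in `R` are of type (1,1) by assumption, used for `σ` and for
`Kσ`. For the rest, `(∇_{IX} K)(∇_{IY} K) = K (∇_X K) K (∇_Y K) = -K² (∇_X K)(∇_Y K) = (∇_X K)(∇_Y
K)`. The formula needs `IX` and `IY` smooth, hence `contMDiff_complexStr`. -/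
theorem nablaPrime_curvatureType [IsManifold 𝓘(ℂ, EM) ω M]
    {cov : CovariantDerivative 𝓘(ℝ, EM) F V}
    (hcov : cov.ContMDiffCovariantDerivative ∞) (hR : HasCurvatureType11 cov)
    {K : TwistorSection EM F V} (hK : K.IsHolomorphic cov) :
    HasCurvatureType11 (nablaPrime cov K) := by
  intro X Y σ hX hY hσ x
  have hKσ := K.contMDiff.clm_bundle_apply hσ
  have anti : ∀ (v : TangentSpace 𝓘(ℝ, EM) x) (w : V x),
      nablaEndDir cov K x (K.endMDiffAt x) v (K x w) =
        -K x (nablaEndDir cov K x (K.endMDiffAt x) v w) :=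
    fun v w => K.nablaEnd_apply_self cov x w v
  rw [curvature_nablaPrime hcov K hσ (contMDiff_complexStr hX) (contMDiff_complexStr hY),
    curvature_nablaPrime hcov K hσ hX hY, hR X Y σ hX hY hσ, hR X Y _ hX hY hKσ,
    hK.nablaEndDir_complexStr, hK.nablaEndDir_complexStr]
  simp only [ContinuousLinearMap.comp_apply, anti, map_neg, K.apply_apply, neg_neg]

end NablaPrime

/-! ### Real and imaginary parts in `ℂ ⊗ W` -/

section ComplexifiedModule

variable {W W' : Type*} [AddCommGroup W] [Module ℝ W] [AddCommGroup W'] [Module ℝ W']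

@[simp] theorem reC_tmul (c : ℂ) (w : W) : reC (c ⊗ₜ[ℝ] w) = c.re • w := by simp [reC]

@[simp] theorem imC_tmul (c : ℂ) (w : W) : imC (c ⊗ₜ[ℝ] w) = c.im • w := by simp [imC]

theorem tmul_reC_add_tmul_imC (z : ℂ ⊗[ℝ] W) :
    (1 : ℂ) ⊗ₜ[ℝ] reC z + Complex.I ⊗ₜ[ℝ] imC z = z := by
  induction z with
  | zero => simp
  | tmul c w =>
    rw [reC_tmul, imC_tmul, TensorProduct.tmul_smul, TensorProduct.tmul_smul,
      TensorProduct.smul_tmul', TensorProduct.smul_tmul', ← TensorProduct.add_tmul]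
    congr 1
    simpa [mul_comm] using Complex.re_add_im c
  | add z z' h h' =>
    rw [map_add, map_add, TensorProduct.tmul_add, TensorProduct.tmul_add]
    nth_rewrite 3 [← h]
    nth_rewrite 3 [← h']
    abel

/-- Reduces identities in the complexification to pairs of real identities; this is how facts about
`∇` and `∇K` pass to `E_ℂ`. -/
theorem complexified_ext {z z' : ℂ ⊗[ℝ] W} (h₁ : reC z = reC z') (h₂ : imC z = imC z') :
    z = z' := by
  rw [← tmul_reC_add_tmul_imC z, ← tmul_reC_add_tmul_imC z', h₁, h₂]

theorem reC_smul (c : ℂ) (z : ℂ ⊗[ℝ] W) : reC (c • z) = c.re • reC z - c.im • imC z := by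
  rw [← tmul_reC_add_tmul_imC z]
  simp [TensorProduct.smul_tmul', sub_eq_add_neg]

theorem imC_smul (c : ℂ) (z : ℂ ⊗[ℝ] W) : imC (c • z) = c.re • imC z + c.im • reC z := by
  rw [← tmul_reC_add_tmul_imC z]
  simp [TensorProduct.smul_tmul', add_comm]

theorem reC_baseChange (A : W →ₗ[ℝ] W') (z : ℂ ⊗[ℝ] W) : reC (A.baseChange ℂ z) = A (reC z) := by
  rw [← tmul_reC_add_tmul_imC z]
  simp

theorem imC_baseChange (A : W →ₗ[ℝ] W') (z : ℂ ⊗[ℝ] W) : imC (A.baseChange ℂ z) = A (imC z) := by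
  rw [← tmul_reC_add_tmul_imC z]
  simp

end ComplexifiedModule

/-! ### Complexified endomorphisms and their eigenspaces -/

section EndC

@[simp] theorem reC_endC (A : Π x : M, V x →L[ℝ] V x) (x : M) (z : ℂ ⊗[ℝ] V x) :
    reC (endC A x z) = A x (reC z) :=
  reC_baseChange _ _

@[simp] theorem imC_endC (A : Π x : M, V x →L[ℝ] V x) (x : M) (z : ℂ ⊗[ℝ] V x) :
    imC (endC A x z) = A x (imC z) :=
  imC_baseChange _ _

theorem endC_add (A B : Π x : M, V x →L[ℝ] V x) (x : M) (z : ℂ ⊗[ℝ] V x) :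
    endC (fun x => A x + B x) x z = endC A x z + endC B x z :=
  complexified_ext (by simp) (by simp)

theorem endC_sub (A B : Π x : M, V x →L[ℝ] V x) (x : M) (z : ℂ ⊗[ℝ] V x) :
    endC (fun x => A x - B x) x z = endC A x z - endC B x z :=
  complexified_ext (by simp) (by simp)

theorem endC_comp (A B : Π x : M, V x →L[ℝ] V x) (x : M) (z : ℂ ⊗[ℝ] V x) :
    endC (fun x => (A x).comp (B x)) x z = endC A x (endC B x z) :=
  complexified_ext (by simp) (by simp)

theorem TwistorSection.endC_endC (J : TwistorSection EM F V) (x : M) (z : ℂ ⊗[ℝ] V x) :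
    endC J x (endC J x z) = -z :=
  complexified_ext (by simp [J.apply_apply]) (by simp [J.apply_apply])

theorem mem_E10 {J : Π x : M, V x →L[ℝ] V x} {x : M} {z : ℂ ⊗[ℝ] V x} :
    z ∈ E10 J x ↔ endC J x z = Complex.I • z :=
  Module.End.mem_eigenspace_iff

theorem mem_E01 {J : Π x : M, V x →L[ℝ] V x} {x : M} {z : ℂ ⊗[ℝ] V x} :
    z ∈ E01 J x ↔ endC J x z = -Complex.I • z :=
  Module.End.mem_eigenspace_iff

end EndC

/-! ### Smooth and differentiable sections of `E_ℂ` -/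

section SmoothSections

variable {e e' : Π x : M, ℂ ⊗[ℝ] V x} {U : Set M}

theorem SmoothOnC.congr (he : SmoothOnC EM F e U) (h : ∀ x ∈ U, e' x = e x) :
    SmoothOnC EM F e' U :=
  ⟨he.1.congr fun x hx => by rw [h x hx], he.2.congr fun x hx => by rw [h x hx]⟩

theorem SmoothOnC.add (he : SmoothOnC EM F e U) (he' : SmoothOnC EM F e' U) :
    SmoothOnC EM F (fun x => e x + e' x) U := by
  have h₁ := he.1.add_section he'.1
  have h₂ := he.2.add_section he'.2
  exact ⟨h₁.congr fun x _ => by simp, h₂.congr fun x _ => by simp⟩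

theorem SmoothOnC.sub (he : SmoothOnC EM F e U) (he' : SmoothOnC EM F e' U) :
    SmoothOnC EM F (fun x => e x - e' x) U := by
  have h₁ := he.1.sub_section he'.1
  have h₂ := he.2.sub_section he'.2
  exact ⟨h₁.congr fun x _ => by simp, h₂.congr fun x _ => by simp⟩

theorem SmoothOnC.endC (he : SmoothOnC EM F e U) (J : TwistorSection EM F V) :
    SmoothOnC EM F (fun x => endC J x (e x)) U := by
  have h₁ := J.contMDiff.contMDiffOn.clm_bundle_apply he.1
  have h₂ := J.contMDiff.contMDiffOn.clm_bundle_apply he.2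
  exact ⟨h₁.congr fun x _ => by simp, h₂.congr fun x _ => by simp⟩

/-- The section `e` of `E_ℂ` is differentiable at `x`. -/
def DiffAtC (EM F : Type*) [NormedAddCommGroup EM] [NormedSpace ℂ EM]
    [NormedAddCommGroup F] [NormedSpace ℝ F] [ChartedSpace EM M]
    {V : M → Type*} [TopologicalSpace (TotalSpace F V)]
    [∀ x, AddCommGroup (V x)] [∀ x, Module ℝ (V x)] [∀ x, TopologicalSpace (V x)]
    [FiberBundle F V] (e : Π x : M, ℂ ⊗[ℝ] V x) (x : M) : Prop :=
  MDifferentiableAt 𝓘(ℝ, EM) (𝓘(ℝ, EM).prod 𝓘(ℝ, F)) (fun x => TotalSpace.mk' F x (reC (e x))) x ∧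
  MDifferentiableAt 𝓘(ℝ, EM) (𝓘(ℝ, EM).prod 𝓘(ℝ, F)) (fun x => TotalSpace.mk' F x (imC (e x))) x

theorem SmoothOnC.diffAtC (he : SmoothOnC EM F e U) (hU : IsOpen U) {x : M} (hx : x ∈ U) :
    DiffAtC EM F e x :=
  ⟨(he.1.contMDiffAt (hU.mem_nhds hx)).mdifferentiableAt (by simp),
    (he.2.contMDiffAt (hU.mem_nhds hx)).mdifferentiableAt (by simp)⟩

end SmoothSections

/-! ### The operators `∇^{0,1}` and `∇'^{0,1}` and the eigenbundles of `J` and `K` -/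

section Dbar

variable {cov : CovariantDerivative 𝓘(ℝ, EM) F V} {e e' : Π x : M, ℂ ⊗[ℝ] V x} {x : M}

@[simp] theorem reC_nablaC (v : TangentSpace 𝓘(ℝ, EM) x) :
    reC (nablaC cov e x v) = cov (fun y => reC (e y)) x v := by
  simp [nablaC]

@[simp] theorem imC_nablaC (v : TangentSpace 𝓘(ℝ, EM) x) :
    imC (nablaC cov e x v) = cov (fun y => imC (e y)) x v := by
  simp [nablaC]

theorem DiffAtC.congr (he : DiffAtC EM F e x) (h : ∀ᶠ y in 𝓝 x, e' y = e y) :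
    DiffAtC EM F e' x :=
  ⟨he.1.congr_of_eventuallyEq (h.mono fun y hy => by simp [hy]),
    he.2.congr_of_eventuallyEq (h.mono fun y hy => by simp [hy])⟩

theorem DiffAtC.add (he : DiffAtC EM F e x) (he' : DiffAtC EM F e' x) :
    DiffAtC EM F (fun y => e y + e' y) x := by
  have h₁ := mdifferentiableAt_add_section he.1 he'.1
  have h₂ := mdifferentiableAt_add_section he.2 he'.2
  exact ⟨h₁.congr_of_eventuallyEq (.of_forall fun y => by simp),
    h₂.congr_of_eventuallyEq (.of_forall fun y => by simp)⟩

theorem DiffAtC.smul (he : DiffAtC EM F e x) (c : ℂ) : DiffAtC EM F (fun y => c • e y) x := by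
  have h₁ := mdifferentiableAt_sub_section (he.1.smul_const_section (a := c.re))
    (he.2.smul_const_section (a := c.im))
  have h₂ := mdifferentiableAt_add_section (he.2.smul_const_section (a := c.re))
    (he.1.smul_const_section (a := c.im))
  exact ⟨h₁.congr_of_eventuallyEq (.of_forall fun y => by simp [reC_smul]),
    h₂.congr_of_eventuallyEq (.of_forall fun y => by simp [imC_smul])⟩

theorem DiffAtC.endC (he : DiffAtC EM F e x) (J : TwistorSection EM F V) :
    DiffAtC EM F (fun y => endC J y (e y)) x := by
  have h₁ := (J.endMDiffAt x).clm_bundle_apply he.1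
  have h₂ := (J.endMDiffAt x).clm_bundle_apply he.2
  exact ⟨h₁.congr_of_eventuallyEq (.of_forall fun y => by simp),
    h₂.congr_of_eventuallyEq (.of_forall fun y => by simp)⟩

theorem nablaC_congr (he : DiffAtC EM F e x) (h : ∀ᶠ y in 𝓝 x, e' y = e y)
    (v : TangentSpace 𝓘(ℝ, EM) x) : nablaC cov e' x v = nablaC cov e x v := by
  have he' := he.congr h
  have hc := cov.isCovariantDerivativeOn (s := Set.univ)
  rw [nablaC, nablaC,
    hc.congr_of_eventuallyEq he'.1 he.1 Filter.univ_mem (h.mono fun y hy => by simp [hy]),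
    hc.congr_of_eventuallyEq he'.2 he.2 Filter.univ_mem (h.mono fun y hy => by simp [hy])]

theorem nablaC_add (he : DiffAtC EM F e x) (he' : DiffAtC EM F e' x)
    (v : TangentSpace 𝓘(ℝ, EM) x) :
    nablaC cov (fun y => e y + e' y) x v = nablaC cov e x v + nablaC cov e' x v := by
  have hc := cov.isCovariantDerivativeOn (s := Set.univ)
  have h₁ : (fun y => reC (e y + e' y)) = (fun y => reC (e y)) + fun y => reC (e' y) := by
    ext y; simp
  have h₂ : (fun y => imC (e y + e' y)) = (fun y => imC (e y)) + fun y => imC (e' y) := by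
    ext y; simp
  refine complexified_ext ?_ ?_
  · rw [reC_nablaC, h₁, hc.add he.1 he'.1, map_add, reC_nablaC, reC_nablaC]
    rfl
  · rw [imC_nablaC, h₂, hc.add he.2 he'.2, map_add, imC_nablaC, imC_nablaC]
    rfl

theorem nablaC_smul (he : DiffAtC EM F e x) (c : ℂ) (v : TangentSpace 𝓘(ℝ, EM) x) :
    nablaC cov (fun y => c • e y) x v = c • nablaC cov e x v := by
  have hc := cov.isCovariantDerivativeOn (s := Set.univ)
  have h₁ : (fun y => reC (c • e y)) = c.re • (fun y => reC (e y)) - c.im • fun y => imC (e y) := by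
    ext y; simp [reC_smul]
  have h₂ : (fun y => imC (c • e y)) = c.re • (fun y => imC (e y)) + c.im • fun y => reC (e y) := by
    ext y; simp [imC_smul]
  refine complexified_ext ?_ ?_
  · rw [reC_smul, reC_nablaC, reC_nablaC, imC_nablaC, h₁]
    rw [cov_sub cov he.1.smul_const_section he.2.smul_const_section,
      hc.smul_const _ he.1, hc.smul_const _ he.2]
    rfl
  · rw [imC_smul, imC_nablaC, reC_nablaC, imC_nablaC, h₂]
    rw [hc.add he.2.smul_const_section he.1.smul_const_section,
      hc.smul_const _ he.1, hc.smul_const _ he.2]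
    rfl

theorem dbar_congr (he : DiffAtC EM F e x) (h : ∀ᶠ y in 𝓝 x, e' y = e y)
    (v : TangentSpace 𝓘(ℝ, EM) x) : dbar cov e' x v = dbar cov e x v := by
  rw [dbar, dbar, nablaC_congr he h, nablaC_congr he h]

theorem dbar_add (he : DiffAtC EM F e x) (he' : DiffAtC EM F e' x)
    (v : TangentSpace 𝓘(ℝ, EM) x) :
    dbar cov (fun y => e y + e' y) x v = dbar cov e x v + dbar cov e' x v := by
  rw [dbar, dbar, dbar, nablaC_add he he', nablaC_add he he']
  module

theorem dbar_smul (he : DiffAtC EM F e x) (c : ℂ) (v : TangentSpace 𝓘(ℝ, EM) x) :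
    dbar cov (fun y => c • e y) x v = c • dbar cov e x v := by
  rw [dbar, dbar, nablaC_smul he, nablaC_smul he]
  module

variable [FiniteDimensional ℝ F] [ContMDiffVectorBundle ∞ F V 𝓘(ℝ, EM)]

/-- The `ℂ`-linear extension of `∇_v K` to `E_ℂ`. -/
def nablaEndC (cov : CovariantDerivative 𝓘(ℝ, EM) F V) (K : TwistorSection EM F V) (x : M)
    (v : TangentSpace 𝓘(ℝ, EM) x) : ℂ ⊗[ℝ] V x →ₗ[ℂ] ℂ ⊗[ℝ] V x :=
  (nablaEndDir cov K x (K.endMDiffAt x) v : V x →ₗ[ℝ] V x).baseChange ℂ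

@[simp] theorem reC_nablaEndC (K : TwistorSection EM F V) (v : TangentSpace 𝓘(ℝ, EM) x)
    (z : ℂ ⊗[ℝ] V x) : reC (nablaEndC cov K x v z) =
      nablaEnd cov K x (K.endMDiffAt x) (reC z) v :=
  reC_baseChange _ _

@[simp] theorem imC_nablaEndC (K : TwistorSection EM F V) (v : TangentSpace 𝓘(ℝ, EM) x)
    (z : ℂ ⊗[ℝ] V x) : imC (nablaEndC cov K x v z) =
      nablaEnd cov K x (K.endMDiffAt x) (imC z) v :=
  imC_baseChange _ _

theorem nablaEndC_endC (K : TwistorSection EM F V) (v : TangentSpace 𝓘(ℝ, EM) x)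
    (z : ℂ ⊗[ℝ] V x) : nablaEndC cov K x v (endC K x z) = -endC K x (nablaEndC cov K x v z) :=
  complexified_ext (by simp [K.nablaEnd_apply_self]) (by simp [K.nablaEnd_apply_self])

theorem nablaC_endC (he : DiffAtC EM F e x) (K : TwistorSection EM F V)
    (v : TangentSpace 𝓘(ℝ, EM) x) :
    nablaC cov (fun y => endC K y (e y)) x v =
      nablaEndC cov K x v (e x) + endC K x (nablaC cov e x v) :=
  complexified_ext (by simp [cov_end_apply cov (K.endMDiffAt x) he.1])
    (by simp [cov_end_apply cov (K.endMDiffAt x) he.2])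

theorem nablaPrime_eq_add (K : TwistorSection EM F V) (σ : Π y : M, V y)
    (v : TangentSpace 𝓘(ℝ, EM) x) :
    nablaPrime cov K σ x v =
      cov σ x v + (1 / 2 : ℝ) • nablaEnd cov K x (K.endMDiffAt x) (K x (σ x)) v :=
  rfl

theorem nablaC_nablaPrime (K : TwistorSection EM F V) (v : TangentSpace 𝓘(ℝ, EM) x) :
    nablaC (nablaPrime cov K) e x v =
      nablaC cov e x v + (1 / 2 : ℂ) • nablaEndC cov K x v (endC K x (e x)) :=
  complexified_ext (by simp [reC_smul, nablaPrime_eq_add])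
    (by simp [imC_smul, nablaPrime_eq_add])

theorem dbar_endC_of_parallel {J : TwistorSection EM F V} (hJ : J.IsParallel cov)
    (he : DiffAtC EM F e x) (v : TangentSpace 𝓘(ℝ, EM) x) :
    dbar cov (fun y => endC J y (e y)) x v = endC J x (dbar cov e x v) := by
  have h : ∀ v, nablaEndC cov J x v (e x) = 0 := fun v =>
    complexified_ext (by simp [hJ x]) (by simp [hJ x])
  rw [dbar, dbar, nablaC_endC he, nablaC_endC he, h, h]
  simp

/-- `J ∇^{0,1} e = ∇^{0,1}(Je) = ∇^{0,1}(ie) = i ∇^{0,1} e`; since `Je = ie` is known only near `x`,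
locality of the operator enters. -/
theorem dbar_mem_E10_of_parallel {J : TwistorSection EM F V} (hJ : J.IsParallel cov)
    (he : DiffAtC EM F e x) (h : ∀ᶠ y in 𝓝 x, e y ∈ E10 J y) (v : TangentSpace 𝓘(ℝ, EM) x) :
    dbar cov e x v ∈ E10 J x := by
  rw [mem_E10, ← dbar_endC_of_parallel hJ he, ← dbar_smul he]
  exact dbar_congr (he.smul _) (h.mono fun y hy => mem_E10.1 hy) v

theorem dbar_mem_E01_of_parallel {J : TwistorSection EM F V} (hJ : J.IsParallel cov)
    (he : DiffAtC EM F e x) (h : ∀ᶠ y in 𝓝 x, e y ∈ E01 J y) (v : TangentSpace 𝓘(ℝ, EM) x) :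
    dbar cov e x v ∈ E01 J x := by
  rw [mem_E01, ← dbar_endC_of_parallel hJ he, ← dbar_smul he]
  exact dbar_congr (he.smul _) (h.mono fun y hy => mem_E01.1 hy) v

variable [IsManifold 𝓘(ℝ, EM) 1 M] {K : TwistorSection EM F V}

theorem nablaEndC_complexStr (hK : K.IsHolomorphic cov) (v : TangentSpace 𝓘(ℝ, EM) x)
    (z : ℂ ⊗[ℝ] V x) :
    nablaEndC cov K x (complexStr x v) z = endC K x (nablaEndC cov K x v z) := by
  have h : ∀ w, nablaEnd cov K x (K.endMDiffAt x) w (complexStr x v) =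
      K x (nablaEnd cov K x (K.endMDiffAt x) w v) :=
    fun w => DFunLike.congr_fun (hK.nablaEndDir_complexStr x v) w
  exact complexified_ext (by simp [h]) (by simp [h])

/-- By `∇_{Iv} K = K ∇_v K`, the failure of `K` to commute with `∇^{0,1}` is `½ (1 + iK) ∇_v K`,
with values in `E^{0,1}_K`. -/
theorem dbar_endC (hK : K.IsHolomorphic cov) (he : DiffAtC EM F e x)
    (v : TangentSpace 𝓘(ℝ, EM) x) :
    dbar cov (fun y => endC K y (e y)) x v = endC K x (dbar cov e x v) +
      (1 / 2 : ℂ) • (nablaEndC cov K x v (e x) +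
        Complex.I • endC K x (nablaEndC cov K x v (e x))) := by
  rw [dbar, dbar, nablaC_endC he, nablaC_endC he, nablaEndC_complexStr hK]
  simp only [map_smul, map_add]
  module

theorem dbar_nablaPrime (hK : K.IsHolomorphic cov) (v : TangentSpace 𝓘(ℝ, EM) x) :
    dbar (nablaPrime cov K) e x v = dbar cov e x v +
      (1 / 4 : ℂ) • (nablaEndC cov K x v (endC K x (e x)) +
        Complex.I • endC K x (nablaEndC cov K x v (endC K x (e x)))) := by
  rw [dbar, dbar, nablaC_nablaPrime, nablaC_nablaPrime, nablaEndC_complexStr hK]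
  module

/-- `∇_v K` anticommutes with `K`, so it sends `E^{0,1}_K` into `E^{1,0}_K`, which `1 + iK`
annihilates. -/
theorem nablaEndC_add_of_mem_E01 (v : TangentSpace 𝓘(ℝ, EM) x) {z : ℂ ⊗[ℝ] V x}
    (hz : z ∈ E01 K x) :
    nablaEndC cov K x v z + Complex.I • endC K x (nablaEndC cov K x v z) = 0 := by
  have h := nablaEndC_endC (cov := cov) K v z
  rw [mem_E01.1 hz, map_smul, neg_smul] at h
  rw [← neg_injective h, smul_smul, Complex.I_mul_I]
  module

/-- The defect in `dbar_endC` vanishes on `E^{0,1}_K`, so the argument for a parallel section goes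
through. It does not apply to `E^{1,0}_K`, and this is where `∇'` is needed. -/
theorem dbar_mem_E01_of_holomorphic (hK : K.IsHolomorphic cov)
    (he : DiffAtC EM F e x) (h : ∀ᶠ y in 𝓝 x, e y ∈ E01 K y) (v : TangentSpace 𝓘(ℝ, EM) x) :
    dbar cov e x v ∈ E01 K x := by
  have h1 := dbar_endC hK he v
  rw [nablaEndC_add_of_mem_E01 v h.self_of_nhds, smul_zero, add_zero] at h1
  rw [mem_E01, ← h1, ← dbar_smul he]
  exact dbar_congr (he.smul _) (h.mono fun y hy => mem_E01.1 hy) v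

/-- On `E^{0,1}_K` the operators `∇^{0,1}` and `∇'^{0,1}` agree. -/
theorem dbar_nablaPrime_of_mem_E01 (hK : K.IsHolomorphic cov) (h : e x ∈ E01 K x)
    (v : TangentSpace 𝓘(ℝ, EM) x) :
    dbar (nablaPrime cov K) e x v = dbar cov e x v := by
  rw [dbar_nablaPrime hK, nablaEndC_add_of_mem_E01 v, smul_zero, add_zero]
  rw [mem_E01.1 h]
  exact Submodule.smul_mem _ _ h

/-- The difference of `∇'^{0,1}` and `∇^{0,1}` takes values in `E^{0,1}_K`. -/
theorem dbar_nablaPrime_add_endC (hK : K.IsHolomorphic cov) (v : TangentSpace 𝓘(ℝ, EM) x) :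
    Complex.I • dbar (nablaPrime cov K) e x v + endC K x (dbar (nablaPrime cov K) e x v) =
      Complex.I • dbar cov e x v + endC K x (dbar cov e x v) := by
  rw [dbar_nablaPrime hK]
  -- The correction term lies in the image of `1 + iK`, and `(i + K)(1 + iK) = 0`.
  simp only [map_add, map_smul, K.endC_endC, smul_add, smul_smul]
  have hI := Complex.I_mul_I
  rw [mul_left_comm, hI]
  module

end Dbar

/-! ### Smoothness of the eigenbundles -/

section Eigenbundles

/-- A linear equivalence that intertwines two real endomorphisms intertwines the eigenspaces of
their complexifications. -/
theorem map_eigenspace_baseChange {W W' : Type*} [AddCommGroup W] [Module ℝ W] [AddCommGroup W']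
    [Module ℝ W'] (E : W ≃ₗ[ℝ] W') {A : W →ₗ[ℝ] W} {B : W' →ₗ[ℝ] W'}
    (h : ∀ w, B (E w) = E (A w)) (c : ℂ) :
    (Module.End.eigenspace (A.baseChange ℂ) c).map ((E : W →ₗ[ℝ] W').baseChange ℂ) =
      Module.End.eigenspace (B.baseChange ℂ) c := by
  have h1 : ∀ z, B.baseChange ℂ ((E : W →ₗ[ℝ] W').baseChange ℂ z) =
      (E : W →ₗ[ℝ] W').baseChange ℂ (A.baseChange ℂ z) := fun z =>
    complexified_ext (by simp [reC_baseChange, h]) (by simp [imC_baseChange, h])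
  have h2 : ∀ z, (E : W →ₗ[ℝ] W').baseChange ℂ ((E.symm : W' →ₗ[ℝ] W).baseChange ℂ z) = z :=
    fun z => complexified_ext (by simp [reC_baseChange]) (by simp [imC_baseChange])
  have h3 : ∀ z, (E.symm : W' →ₗ[ℝ] W).baseChange ℂ ((E : W →ₗ[ℝ] W').baseChange ℂ z) = z :=
    fun z => complexified_ext (by simp [reC_baseChange]) (by simp [imC_baseChange])
  ext z
  simp only [Submodule.mem_map, Module.End.mem_eigenspace_iff]
  constructor
  · rintro ⟨y, hy, rfl⟩
    rw [h1, hy, map_smul]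
  · intro hz
    refine ⟨_, ?_, h2 z⟩
    rw [← h3 (A.baseChange ℂ _), ← h1, h2, hz, map_smul]

variable [FiniteDimensional ℝ F] [ContMDiffVectorBundle ∞ F V 𝓘(ℝ, EM)]

/-- Near every point there is a smooth frame of `E` in which the twistor section `J` has constant
coefficients. -/
theorem TwistorSection.exists_adapted_frame (J : TwistorSection EM F V) (x₀ : M) :
    ∃ (U : Set M) (J₀ : F →L[ℝ] F) (G : Π x : M, F →ₗ[ℝ] V x), IsOpen U ∧ x₀ ∈ U ∧
      (∀ c, ContMDiffOn 𝓘(ℝ, EM) (𝓘(ℝ, EM).prod 𝓘(ℝ, F)) ∞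
        (fun x => TotalSpace.mk' F x (G x c)) U) ∧
      ∀ x ∈ U, Function.Bijective (G x) ∧ ∀ c, J x (G x c) = G x (J₀ c) := by
  set T := trivializationAt F V x₀
  have hx₀ : x₀ ∈ T.baseSet := FiberBundle.mem_baseSet_trivializationAt F V x₀
  let Jt : M → F →L[ℝ] F := fun x =>
    (T.continuousLinearMapAt ℝ x).comp ((J x).comp (T.symmL ℝ x))
  have hJt : ∀ x ∈ T.baseSet, ∀ c, Jt x (Jt x c) = -c := by
    intro x hx c
    change T.continuousLinearMapAt ℝ x (J x (T.symmL ℝ x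
      (T.continuousLinearMapAt ℝ x (J x (T.symmL ℝ x c))))) = -c
    rw [T.symmL_continuousLinearMapAt hx, J.apply_apply, map_neg, T.continuousLinearMapAt_symmL hx]
  have hcont : ContinuousAt Jt x₀ := by
    have h := ((contMDiffAt_hom_bundle _).1 (J.contMDiff x₀)).2.continuousAt
    exact h
  -- Averaging the identity into an intertwiner: `J_x g = ½ (J_x + J_{x₀}) = g J_{x₀}`, as both
  -- squares are `-1`. The factor `½` makes `g` the identity at `x₀`, so it is invertible nearby.
  let g : M → F →L[ℝ] F := fun x => (1 / 2 : ℝ) • (1 - Jt x * Jt x₀)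
  have hg₀ : g x₀ = 1 := by
    ext c
    change (1 / 2 : ℝ) • (c - Jt x₀ (Jt x₀ c)) = c
    rw [hJt x₀ hx₀]
    module
  have hgcont : ContinuousAt g x₀ :=
    (continuousAt_const.sub (hcont.mul (continuousAt_const (y := Jt x₀)))).const_smul (1 / 2 : ℝ)
  have hunit : ∀ᶠ x in 𝓝 x₀, IsUnit (g x) :=
    hgcont (Units.isOpen.mem_nhds (by rw [hg₀]; exact isUnit_one))
  obtain ⟨U, hU, hUo, hxU⟩ := eventually_nhds_iff.1 (hunit.and (T.open_baseSet.mem_nhds hx₀))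
  -- This is `g` followed by the inverse trivialization, written directly in terms of `J` so that
  -- its smoothness is visible.
  let G : Π x : M, F →ₗ[ℝ] V x := fun x =>
    (1 / 2 : ℝ) • ((T.symmL ℝ x : F →ₗ[ℝ] V x) -
      (J x : V x →ₗ[ℝ] V x) ∘ₗ (T.symmL ℝ x : F →ₗ[ℝ] V x) ∘ₗ (Jt x₀ : F →ₗ[ℝ] F))
  refine ⟨U, Jt x₀, G, hUo, hxU, fun c => ?_, fun x hx => ⟨?_, fun c => ?_⟩⟩
  · have hsub : U ⊆ T.baseSet := fun x hx => (hU x hx).2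
    have h1 := (contMDiffOn_symmL_section (EM := EM) T c).mono hsub
    have h2 := J.contMDiff.contMDiffOn.clm_bundle_apply
      ((contMDiffOn_symmL_section (EM := EM) T (Jt x₀ c)).mono hsub)
    exact (h1.sub_section h2).const_smul_section (a := (1 / 2 : ℝ))
  · have hb := (hU x hx).2
    have hG : ∀ c, G x c = (T.continuousLinearEquivAt ℝ x hb).symm (g x c) := by
      intro c
      rw [ContinuousLinearEquiv.eq_symm_apply]
      have h := congrFun (T.coe_continuousLinearEquivAt_eq (R := ℝ) hb) (G x c)
      refine h.trans ?_
      change T.continuousLinearMapAt ℝ x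
        ((1 / 2 : ℝ) • (T.symmL ℝ x c - J x (T.symmL ℝ x (Jt x₀ c)))) =
          (1 / 2 : ℝ) • (c - Jt x (Jt x₀ c))
      rw [map_smul, map_sub, T.continuousLinearMapAt_symmL hb]
      rfl
    have hgb : Function.Bijective (g x) := by
      obtain ⟨u, hu⟩ := (hU x hx).1
      rw [← hu]
      exact (ContinuousLinearEquiv.unitsEquiv ℝ F u).bijective
    have hcomp : ⇑(G x) = (T.continuousLinearEquivAt ℝ x hb).symm ∘ g x := funext hG
    rw [hcomp]
    exact (T.continuousLinearEquivAt ℝ x hb).symm.bijective.comp hgb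
  · simp only [G, LinearMap.smul_apply, LinearMap.sub_apply, LinearMap.comp_apply,
      ContinuousLinearMap.coe_coe, map_smul, map_sub, J.apply_apply, hJt x₀ hx₀, map_neg]
    module

/-- An adapted frame carries the eigenspace of one fixed endomorphism `J₀` onto the eigenspaces of
`J` at all nearby points, so a basis of the former gives a smooth local frame of the latter. -/
theorem TwistorSection.isSmoothSubbundle_eigenspace (J : TwistorSection EM F V) (c : ℂ) :
    IsSmoothSubbundle EM F (fun x => Module.End.eigenspace (endC J x) c) := by
  intro x₀
  obtain ⟨U, J₀, G, hUo, hxU, hsm, hG⟩ := J.exists_adapted_frame x₀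
  let S := Module.End.eigenspace ((J₀ : F →ₗ[ℝ] F).baseChange ℂ) c
  let b := Module.finBasis ℂ S
  refine ⟨U, _, fun j x => (G x).baseChange ℂ (b j), hUo, hxU, fun j => ⟨?_, ?_⟩, fun x hx => ?_⟩
  · exact (hsm (reC (b j : ℂ ⊗[ℝ] F))).congr fun x _ => by rw [reC_baseChange]
  · exact (hsm (imC (b j : ℂ ⊗[ℝ] F))).congr fun x _ => by rw [imC_baseChange]
  · let E : F ≃ₗ[ℝ] V x := LinearEquiv.ofBijective (G x) (hG x hx).1
    have hmap := map_eigenspace_baseChange E (A := (J₀ : F →ₗ[ℝ] F)) (B := (J x : V x →ₗ[ℝ] V x))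
      (hG x hx).2 c
    have hinj : Function.Injective ((G x).baseChange ℂ) := by
      intro z z' h
      refine complexified_ext ((hG x hx).1.1 ?_) ((hG x hx).1.1 ?_)
      · rw [← reC_baseChange, h, reC_baseChange]
      · rw [← imC_baseChange, h, imC_baseChange]
    refine ⟨?_, ?_⟩
    · exact (b.linearIndependent.map' S.subtype (Submodule.ker_subtype _)).map'
        ((G x).baseChange ℂ) (LinearMap.ker_eq_bot.2 hinj)
    · have h1 : (Set.range fun j => (G x).baseChange ℂ (b j)) =
          ((G x).baseChange ℂ) '' (S.subtype '' Set.range b) := by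
        rw [← Set.range_comp, ← Set.range_comp]; rfl
      rw [h1, Submodule.span_image, Submodule.span_image, b.span_eq, Submodule.map_top,
        Submodule.range_subtype]
      exact hmap

end Eigenbundles

/-! ### Eigenbundles as holomorphic subbundles -/

section HolomorphicSubbundles

variable [FiniteDimensional ℝ F] [ContMDiffVectorBundle ∞ F V 𝓘(ℝ, EM)]
  [IsManifold 𝓘(ℝ, EM) 1 M] {cov : CovariantDerivative 𝓘(ℝ, EM) F V}

theorem TwistorSection.IsParallel.isHolomorphicSubbundle_E10 {J : TwistorSection EM F V}
    (hJ : J.IsParallel cov) (hcov : cov.ContMDiffCovariantDerivative ∞)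
    (hR : HasCurvatureType11 cov) : IsHolomorphicSubbundle cov (E10 J) where
  smooth_connection := hcov
  curvature_type := hR
  subbundle := J.isSmoothSubbundle_eigenspace _
  dbar_mem _ hU _ he h _ hx v := dbar_mem_E10_of_parallel hJ (he.diffAtC hU hx)
    (Filter.eventually_of_mem (hU.mem_nhds hx) h) v

theorem TwistorSection.IsParallel.isHolomorphicSubbundle_E01 {J : TwistorSection EM F V}
    (hJ : J.IsParallel cov) (hcov : cov.ContMDiffCovariantDerivative ∞)
    (hR : HasCurvatureType11 cov) : IsHolomorphicSubbundle cov (E01 J) where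
  smooth_connection := hcov
  curvature_type := hR
  subbundle := J.isSmoothSubbundle_eigenspace _
  dbar_mem _ hU _ he h _ hx v := dbar_mem_E01_of_parallel hJ (he.diffAtC hU hx)
    (Filter.eventually_of_mem (hU.mem_nhds hx) h) v

theorem TwistorSection.IsHolomorphic.isHolomorphicSubbundle_E01 {K : TwistorSection EM F V}
    (hK : K.IsHolomorphic cov) (hcov : cov.ContMDiffCovariantDerivative ∞)
    (hR : HasCurvatureType11 cov) : IsHolomorphicSubbundle cov (E01 K) where
  smooth_connection := hcov
  curvature_type := hR
  subbundle := K.isSmoothSubbundle_eigenspace _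
  dbar_mem _ hU _ he h _ hx v := dbar_mem_E01_of_holomorphic hK (he.diffAtC hU hx)
    (Filter.eventually_of_mem (hU.mem_nhds hx) h) v

end HolomorphicSubbundles

/-! ### Smoothness of `J + K`, `J - K` and `[J, K]` -/

section BundleMaps

variable {J K : TwistorSection EM F V} {e : Π x : M, ℂ ⊗[ℝ] V x} {U : Set M}

theorem SmoothOnC.endC_add (he : SmoothOnC EM F e U) (J K : TwistorSection EM F V) :
    SmoothOnC EM F (fun x => HolTwistor.endC (fun x => J x + K x) x (e x)) U :=
  ((he.endC J).add (he.endC K)).congr fun _ _ => HolTwistor.endC_add _ _ _ _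

theorem SmoothOnC.endC_sub (he : SmoothOnC EM F e U) (J K : TwistorSection EM F V) :
    SmoothOnC EM F (fun x => HolTwistor.endC (fun x => J x - K x) x (e x)) U :=
  ((he.endC J).sub (he.endC K)).congr fun _ _ => HolTwistor.endC_sub _ _ _ _

theorem endC_commutator (J K : Π x : M, V x →L[ℝ] V x) (x : M) (z : ℂ ⊗[ℝ] V x) :
    endC (fun x => (J x).comp (K x) - (K x).comp (J x)) x z =
      endC J x (endC K x z) - endC K x (endC J x z) := by
  rw [endC_sub (fun x => (J x).comp (K x)), endC_comp, endC_comp]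

theorem SmoothOnC.endC_commutator (he : SmoothOnC EM F e U) (J K : TwistorSection EM F V) :
    SmoothOnC EM F
      (fun x => HolTwistor.endC (fun x => (J x).comp (K x) - (K x).comp (J x)) x (e x)) U :=
  (((he.endC K).endC J).sub ((he.endC J).endC K)).congr fun _ _ =>
    HolTwistor.endC_commutator _ _ _ _

end BundleMaps

/-! ### The holomorphic bundle maps -/

section HolomorphicMaps

variable {cov : CovariantDerivative 𝓘(ℝ, EM) F V} {e e' : Π x : M, ℂ ⊗[ℝ] V x} {x : M}

theorem dbar_sub (he : DiffAtC EM F e x) (he' : DiffAtC EM F e' x)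
    (v : TangentSpace 𝓘(ℝ, EM) x) :
    dbar cov (fun y => e y - e' y) x v = dbar cov e x v - dbar cov e' x v := by
  have h : (fun y => e y - e' y) = fun y => e y + (-1 : ℂ) • e' y := by
    ext y; module
  rw [h, dbar_add he (he'.smul _), dbar_smul he']
  module

variable [FiniteDimensional ℝ F] [ContMDiffVectorBundle ∞ F V 𝓘(ℝ, EM)]
  [IsManifold 𝓘(ℝ, EM) 1 M] {J K : TwistorSection EM F V}

/-- If `W` is a holomorphic subbundle of `(E_ℂ, ∇^{0,1})` on which `J` acts as the scalar `c`, then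
`∇^{0,1}` commutes with `J` on sections of `W`. -/
theorem IsHolomorphicSubbundle.dbar_endC_of_eigen {W : Π x : M, Submodule ℂ (ℂ ⊗[ℝ] V x)} {c : ℂ}
    (hW : IsHolomorphicSubbundle cov W) (hc : ∀ x, ∀ z ∈ W x, endC J x z = c • z)
    {U : Set M} (hU : IsOpen U) (he : SmoothOnC EM F e U) (h : ∀ x ∈ U, e x ∈ W x) (hx : x ∈ U)
    (v : TangentSpace 𝓘(ℝ, EM) x) :
    dbar cov (fun y => endC J y (e y)) x v = endC J x (dbar cov e x v) := by
  rw [hc x _ (hW.dbar_mem U hU e he h x hx v), ← dbar_smul (he.diffAtC hU hx)]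
  exact dbar_congr ((he.diffAtC hU hx).smul _)
    (Filter.eventually_of_mem (hU.mem_nhds hx) fun y hy => hc y _ (h y hy)) v

/-- On `E^{0,1}_K` the map is `J - i`, and `J (J - i) = -i (J - i)`. It commutes with `∇^{0,1}`
since `J` is parallel and `K` is the constant `-i` on a bundle that `∇^{0,1}` preserves. -/
theorem isHolomorphicBundleMap_add_E01 (hcov : cov.ContMDiffCovariantDerivative ∞)
    (hR : HasCurvatureType11 cov) (hJ : J.IsParallel cov) (hK : K.IsHolomorphic cov) :
    IsHolomorphicBundleMap cov (E01 K) cov (E01 J) (endC fun x => J x + K x) where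
  source := hK.isHolomorphicSubbundle_E01 hcov hR
  target := hJ.isHolomorphicSubbundle_E01 hcov hR
  mapsTo x w hw := by
    rw [mem_E01] at hw ⊢
    rw [endC_add, hw, map_add, map_smul, J.endC_endC, smul_add, smul_smul, neg_mul_neg,
      Complex.I_mul_I]
    module
  smooth _ _ _ he _ := he.endC_add J K
  dbar_comm U hU e he h x hx v := by
    have hd := he.diffAtC hU hx
    simp only [endC_add]
    rw [dbar_add (hd.endC J) (hd.endC K), dbar_endC_of_parallel hJ hd,
      (hK.isHolomorphicSubbundle_E01 hcov hR).dbar_endC_of_eigen (fun _ _ => mem_E01.1) hU he h hx]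

/-- Here the map is `J + i` on `E^{0,1}_K`, and `J (J + i) = i (J + i)`. -/
theorem isHolomorphicBundleMap_sub_E01 (hcov : cov.ContMDiffCovariantDerivative ∞)
    (hR : HasCurvatureType11 cov) (hJ : J.IsParallel cov) (hK : K.IsHolomorphic cov) :
    IsHolomorphicBundleMap cov (E01 K) cov (E10 J) (endC fun x => J x - K x) where
  source := hK.isHolomorphicSubbundle_E01 hcov hR
  target := hJ.isHolomorphicSubbundle_E10 hcov hR
  mapsTo x w hw := by
    rw [mem_E01] at hw
    rw [mem_E10, endC_sub, hw, map_sub, map_smul, J.endC_endC, smul_sub, smul_smul, mul_neg,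
      Complex.I_mul_I]
    module
  smooth _ _ _ he _ := he.endC_sub J K
  dbar_comm U hU e he h x hx v := by
    have hd := he.diffAtC hU hx
    simp only [endC_sub]
    rw [dbar_sub (hd.endC J) (hd.endC K), dbar_endC_of_parallel hJ hd,
      (hK.isHolomorphicSubbundle_E01 hcov hR).dbar_endC_of_eigen (fun _ _ => mem_E01.1) hU he h hx]

variable [IsManifold 𝓘(ℂ, EM) ω M]

theorem isHolomorphicSubbundle_nablaPrime_E10 (hcov : cov.ContMDiffCovariantDerivative ∞)
    (hR : HasCurvatureType11 cov) (hK : K.IsHolomorphic cov) :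
    IsHolomorphicSubbundle (nablaPrime cov K) (E10 K) :=
  (nablaPrime_parallel cov K).isHolomorphicSubbundle_E10 (nablaPrime_smooth hcov K)
    (nablaPrime_curvatureType hcov hR hK)

theorem isHolomorphicSubbundle_nablaPrime_E01 (hcov : cov.ContMDiffCovariantDerivative ∞)
    (hR : HasCurvatureType11 cov) (hK : K.IsHolomorphic cov) :
    IsHolomorphicSubbundle (nablaPrime cov K) (E01 K) :=
  (nablaPrime_parallel cov K).isHolomorphicSubbundle_E01 (nablaPrime_smooth hcov K)
    (nablaPrime_curvatureType hcov hR hK)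

/-- The map `i + K : (E_ℂ, ∇^{0,1}) → (E_ℂ, ∇'^{0,1})` commutes with the `∂̄`-operators. -/
theorem dbar_nablaPrime_I_add_endC (hK : K.IsHolomorphic cov) (he : DiffAtC EM F e x)
    (v : TangentSpace 𝓘(ℝ, EM) x) :
    dbar (nablaPrime cov K) (fun y => Complex.I • e y + endC K y (e y)) x v =
      Complex.I • dbar cov e x v + endC K x (dbar cov e x v) := by
  rw [dbar_add (he.smul _) (he.endC K), dbar_smul he,
    dbar_endC_of_parallel (nablaPrime_parallel cov K) he, dbar_nablaPrime_add_endC hK]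

/-- `i + K` is `2i` times the projection `½ (1 - iK)` onto `E^{1,0}_K`. -/
theorem TwistorSection.I_add_endC_mem_E10 (K : TwistorSection EM F V) (z : ℂ ⊗[ℝ] V x) :
    Complex.I • z + endC K x z ∈ E10 K x := by
  rw [mem_E10, map_add, map_smul, K.endC_endC, smul_add, smul_smul, Complex.I_mul_I]
  module

/-- A bundle map that is `c (i + K) g` on `W`, where `g` is holomorphic, is holomorphic. -/
theorem isHolomorphicBundleMap_of_eq_I_add_endC {cov' : CovariantDerivative 𝓘(ℝ, EM) F V}
    {W : Π x : M, Submodule ℂ (ℂ ⊗[ℝ] V x)} {f g : Π x : M, ℂ ⊗[ℝ] V x →ₗ[ℂ] ℂ ⊗[ℝ] V x} (c : ℂ)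
    (hcov : cov.ContMDiffCovariantDerivative ∞) (hR : HasCurvatureType11 cov)
    (hK : K.IsHolomorphic cov) (hW : IsHolomorphicSubbundle cov' W)
    (hf : ∀ x, ∀ z ∈ W x, f x z = c • (Complex.I • g x z + endC K x (g x z)))
    (hsmooth : ∀ (U : Set M), IsOpen U → ∀ e : Π x : M, ℂ ⊗[ℝ] V x, SmoothOnC EM F e U →
      (∀ x ∈ U, e x ∈ W x) → SmoothOnC EM F (fun x => f x (e x)) U)
    (hg : ∀ (U : Set M), IsOpen U → ∀ e : Π x : M, ℂ ⊗[ℝ] V x, SmoothOnC EM F e U →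
      (∀ x ∈ U, e x ∈ W x) → ∀ x ∈ U, DiffAtC EM F (fun y => g y (e y)) x ∧
        ∀ v, dbar cov (fun y => g y (e y)) x v = g x (dbar cov' e x v)) :
    IsHolomorphicBundleMap cov' W (nablaPrime cov K) (E10 K) f where
  source := hW
  target := isHolomorphicSubbundle_nablaPrime_E10 hcov hR hK
  mapsTo x w hw := by
    rw [hf x w hw]
    exact Submodule.smul_mem _ _ (K.I_add_endC_mem_E10 _)
  smooth := hsmooth
  dbar_comm U hU e he h x hx v := by
    obtain ⟨hd, hdb⟩ := hg U hU e he h x hx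
    have hd' := (hd.smul Complex.I).add (hd.endC K)
    rw [dbar_congr (hd'.smul c)
        (Filter.eventually_of_mem (hU.mem_nhds hx) fun y hy => hf y _ (h y hy)),
      dbar_smul hd', dbar_nablaPrime_I_add_endC hK hd, hdb,
      hf x _ (hW.dbar_mem U hU e he h x hx v)]

theorem isHolomorphicBundleMap_add_E10 (hcov : cov.ContMDiffCovariantDerivative ∞)
    (hR : HasCurvatureType11 cov) (hJ : J.IsParallel cov) (hK : K.IsHolomorphic cov) :
    IsHolomorphicBundleMap cov (E10 J) (nablaPrime cov K) (E10 K) (endC fun x => J x + K x) := by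
  refine isHolomorphicBundleMap_of_eq_I_add_endC (g := fun _ => LinearMap.id) 1 hcov hR hK
    (hJ.isHolomorphicSubbundle_E10 hcov hR) (fun x z hz => ?_)
    (fun U _ e he _ => he.endC_add J K) (fun U hU e he _ x hx => ⟨he.diffAtC hU hx, fun v => rfl⟩)
  rw [endC_add, mem_E10.1 hz, one_smul, LinearMap.id_apply]

theorem isHolomorphicBundleMap_sub_E01_E10 (hcov : cov.ContMDiffCovariantDerivative ∞)
    (hR : HasCurvatureType11 cov) (hJ : J.IsParallel cov) (hK : K.IsHolomorphic cov) :
    IsHolomorphicBundleMap cov (E01 J) (nablaPrime cov K) (E10 K) (endC fun x => J x - K x) := by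
  refine isHolomorphicBundleMap_of_eq_I_add_endC (g := fun _ => LinearMap.id) (-1) hcov hR hK
    (hJ.isHolomorphicSubbundle_E01 hcov hR) (fun x z hz => ?_)
    (fun U _ e he _ => he.endC_sub J K) (fun U hU e he _ x hx => ⟨he.diffAtC hU hx, fun v => rfl⟩)
  rw [endC_sub, mem_E01.1 hz, LinearMap.id_apply]
  module

/-- With `K = -i` on `z`, `JK - KJ` becomes `-iJ - KJ`. -/
theorem endC_commutator_of_mem_E01 {z : ℂ ⊗[ℝ] V x} (hz : z ∈ E01 K x) :
    endC (fun x => (J x).comp (K x) - (K x).comp (J x)) x z =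
      (-1 : ℂ) • (Complex.I • endC J x z + endC K x (endC J x z)) := by
  rw [endC_commutator, mem_E01.1 hz, map_smul]
  module

theorem isHolomorphicBundleMap_commutator (hcov : cov.ContMDiffCovariantDerivative ∞)
    (hR : HasCurvatureType11 cov) (hJ : J.IsParallel cov) (hK : K.IsHolomorphic cov) :
    IsHolomorphicBundleMap cov (E01 K) (nablaPrime cov K) (E10 K)
      (endC fun x => (J x).comp (K x) - (K x).comp (J x)) :=
  isHolomorphicBundleMap_of_eq_I_add_endC (g := endC J) (-1) hcov hR hK
    (hK.isHolomorphicSubbundle_E01 hcov hR) (fun _ _ hz => endC_commutator_of_mem_E01 hz)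
    (fun _ _ _ he _ => he.endC_commutator J K) (fun _ hU _ he _ _ hx =>
      ⟨(he.diffAtC hU hx).endC J, dbar_endC_of_parallel hJ (he.diffAtC hU hx)⟩)

/-- Only the operator on the source changes, and on `E^{0,1}_K` the two operators coincide. -/
theorem isHolomorphicBundleMap_commutator_nablaPrime (hcov : cov.ContMDiffCovariantDerivative ∞)
    (hR : HasCurvatureType11 cov) (hJ : J.IsParallel cov) (hK : K.IsHolomorphic cov) :
    IsHolomorphicBundleMap (nablaPrime cov K) (E01 K) (nablaPrime cov K) (E10 K)
      (endC fun x => (J x).comp (K x) - (K x).comp (J x)) :=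
  isHolomorphicBundleMap_of_eq_I_add_endC (g := endC J) (-1) hcov hR hK
    (isHolomorphicSubbundle_nablaPrime_E01 hcov hR hK) (fun _ _ hz => endC_commutator_of_mem_E01 hz)
    (fun _ _ _ he _ => he.endC_commutator J K) (fun _ hU _ he h x hx =>
      ⟨(he.diffAtC hU hx).endC J, fun v => by
        rw [dbar_endC_of_parallel hJ (he.diffAtC hU hx), dbar_nablaPrime_of_mem_E01 hK (h x hx)]⟩)

end HolomorphicMaps

end HolTwistor

end

theorem mainTheorem2
    {EM : Type*} [NormedAddCommGroup EM] [NormedSpace ℂ EM] [FiniteDimensional ℂ EM]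
    {M : Type*} [TopologicalSpace M] [T2Space M] [ChartedSpace EM M] [IsManifold 𝓘(ℂ, EM) ω M]
    {F : Type*} [NormedAddCommGroup F] [NormedSpace ℝ F] [FiniteDimensional ℝ F]
    {V : M → Type*} [TopologicalSpace (TotalSpace F V)]
    [∀ x, AddCommGroup (V x)] [∀ x, Module ℝ (V x)] [∀ x, TopologicalSpace (V x)]
    [∀ x, IsTopologicalAddGroup (V x)] [∀ x, ContinuousSMul ℝ (V x)]
    [FiberBundle F V] [VectorBundle ℝ F V] [ContMDiffVectorBundle ∞ F V 𝓘(ℝ, EM)]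
    (cov : CovariantDerivative 𝓘(ℝ, EM) F V) (hcov : cov.ContMDiffCovariantDerivative ∞)
    (hR : HolTwistor.HasCurvatureType11 cov)
    (J K : HolTwistor.TwistorSection EM F V)
    (hJ : J.IsParallel cov) (hK : K.IsHolomorphic cov) :
    HolTwistor.IsHolomorphicBundleMap cov (HolTwistor.E01 K) cov (HolTwistor.E01 J)
      (HolTwistor.endC fun x => J x + K x) ∧
    HolTwistor.IsHolomorphicBundleMap cov (HolTwistor.E01 K) cov (HolTwistor.E10 J)
      (HolTwistor.endC fun x => J x - K x) ∧
    HolTwistor.IsHolomorphicBundleMap cov (HolTwistor.E10 J)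
      (HolTwistor.nablaPrime cov K) (HolTwistor.E10 K)
      (HolTwistor.endC fun x => J x + K x) ∧
    HolTwistor.IsHolomorphicBundleMap cov (HolTwistor.E01 J)
      (HolTwistor.nablaPrime cov K) (HolTwistor.E10 K)
      (HolTwistor.endC fun x => J x - K x) ∧
    HolTwistor.IsHolomorphicBundleMap cov (HolTwistor.E01 K)
      (HolTwistor.nablaPrime cov K) (HolTwistor.E10 K)
      (HolTwistor.endC fun x => (J x).comp (K x) - (K x).comp (J x)) ∧
    HolTwistor.IsHolomorphicBundleMap (HolTwistor.nablaPrime cov K) (HolTwistor.E01 K)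
      (HolTwistor.nablaPrime cov K) (HolTwistor.E10 K)
      (HolTwistor.endC fun x => (J x).comp (K x) - (K x).comp (J x)) := by
  exact ⟨HolTwistor.isHolomorphicBundleMap_add_E01 hcov hR hJ hK,
    HolTwistor.isHolomorphicBundleMap_sub_E01 hcov hR hJ hK,
    HolTwistor.isHolomorphicBundleMap_add_E10 hcov hR hJ hK,
    HolTwistor.isHolomorphicBundleMap_sub_E01_E10 hcov hR hJ hK,
    HolTwistor.isHolomorphicBundleMap_commutator hcov hR hJ hK,
    HolTwistor.isHolomorphicBundleMap_commutator_nablaPrime hcov hR hJ hK⟩
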